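/- **Lemma.** Let $d=p_1^{e_1}\cdots p_k^{e_k}$ with distinct primes $p_1,\dots,p_k$ and exponents $e_i\ge 1$. Let $A$ be a natural number such that $A\mid p_i-1$ for every $i$, and write $p_i=b_iA+1$. Suppose that $$A^{k+1}>\binom{k}{\lfloor k/2\rfloor}\,d .$$ Then $e_1=\dots=e_k=1$; the base-$A$ expansion of $d$ has the form $d=1+a_1A+\dots+a_kA^k$ with $0\le a_i<A$; and the polynomial $g=1+a_1X+\dots+a_kX^k$ satisfies $$g=(b_1X+1)\cdots(b_kX+1)\quad\text{in }\mathbb{Z}[X].$$ Furthermore, for $k\ge 1$ this factorization can be obtained by the Berlekamp–Hensel method in $O\bigl((\ln d)^5(\ln\ln d)^2\bigr)$ deterministic time, with an absolute implied constant. That is, there are an absolute constant $K$ and one deterministic program (a random access program on natural numbers, in which every operation is charged its schoolbook bit cost) such that, on input $(d,A)$ as above with $k\ge 1$, the program halts after at most $K(\ln d)^5(\ln\ln d)^2$ bit operations and outputs, for some ordering of the $b_i$: * the number $k$; * the least prime $q$ with $q\nmid a_k$ such that $g$ is squarefree modulo $q$; * the complete factorization $g\equiv a_k\prod_{i=1}^k(X+\beta_i)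 \pmod q$, with $0\le\beta_i<q$; * the exponent $m=\lceil \ln d/\ln q\rceil$ and the lifted factorization $g\equiv a_k\prod_{i=1}^k(X+c_i)\pmod{q^m}$, with $0\le c_i<q^m$ and $c_i\equiv\beta_i\pmod q$; * the numbers $b_1,\dots,b_k$, where $0\le b_i<q^m$ and $b_ic_i\equiv 1\pmod{q^m}$. -/

import Mathlib

open Polynomial

/-! ### Deterministic programs and their bit cost

A structured random access machine over the natural numbers. A state consists of registers and of
arrays, all holding natural numbers. Programs are finite pieces of syntax, so they touch finitely
many registers and array names; arrays are indexed by computed values. Every operation is charged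
the number of bit operations of the classical (schoolbook) algorithms, where `Nat.size n` is the
number of binary digits of `n`. -/

/-- A memory state: registers `reg i` and array cells `arr a i`. -/
structure MachineState where
  reg : ℕ → ℕ
  arr : ℕ → ℕ → ℕ

/-- Expressions; `sub` is truncated subtraction, `div` and `mod` are division with remainder. -/
inductive MachineExpr where
  | const (n : ℕ)
  | reg (i : ℕ)
  | get (a : ℕ) (idx : MachineExpr)
  | add (x y : MachineExpr)
  | sub (x y : MachineExpr)
  | mul (x y : MachineExpr)
  | div (x y : MachineExpr)
  | mod (x y : MachineExpr)

/-- The value of an expression in a state. -/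
def MachineExpr.eval (s : MachineState) : MachineExpr → ℕ
  | .const n => n
  | .reg i => s.reg i
  | .get a idx => s.arr a (idx.eval s)
  | .add x y => x.eval s + y.eval s
  | .sub x y => x.eval s - y.eval s
  | .mul x y => x.eval s * y.eval s
  | .div x y => x.eval s / y.eval s
  | .mod x y => x.eval s % y.eval s

/-- The bit cost of evaluating an expression: reading a number costs its length, reading an array
cell costs in addition the length of the index, addition and subtraction are linear in the lengths
of the operands, multiplication and division cost the product of these lengths. -/
def MachineExpr.cost (s : MachineState) : MachineExpr → ℕ
  | .const n => n.size + 1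
  | .reg i => (s.reg i).size + 1
  | .get a idx => idx.cost s + (idx.eval s).size + (s.arr a (idx.eval s)).size + 1
  | .add x y => x.cost s + y.cost s + ((x.eval s).size + (y.eval s).size + 1)
  | .sub x y => x.cost s + y.cost s + ((x.eval s).size + (y.eval s).size + 1)
  | .mul x y => x.cost s + y.cost s + ((x.eval s).size + 1) * ((y.eval s).size + 1)
  | .div x y => x.cost s + y.cost s + ((x.eval s).size + 1) * ((y.eval s).size + 1)
  | .mod x y => x.cost s + y.cost s + ((x.eval s).size + 1) * ((y.eval s).size + 1)

/-- Programs; a test succeeds when its value is nonzero. -/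
inductive MachineProg where
  | skip
  | assign (i : ℕ) (x : MachineExpr)
  | put (a : ℕ) (idx x : MachineExpr)
  | seq (P Q : MachineProg)
  | ite (test : MachineExpr) (P Q : MachineProg)
  | while (test : MachineExpr) (P : MachineProg)

/-- Write `v` into register `i`. -/
def MachineState.setReg (s : MachineState) (i v : ℕ) : MachineState :=
  { s with reg := Function.update s.reg i v }

/-- Write `v` into cell `j` of the array `a`. -/
def MachineState.setArr (s : MachineState) (a j v : ℕ) : MachineState :=
  { s with arr := Function.update s.arr a (Function.update (s.arr a) j v) }

/-- `Exec P s s' t`: started in the state `s`, the program `P` halts in the state `s'` after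
exactly `t` bit operations. -/
inductive MachineProg.Exec : MachineProg → MachineState → MachineState → ℕ → Prop where
  | skip (s : MachineState) : Exec .skip s s 1
  | assign (i : ℕ) (x : MachineExpr) (s : MachineState) :
      Exec (.assign i x) s (s.setReg i (x.eval s)) (x.cost s + 1)
  | put (a : ℕ) (idx x : MachineExpr) (s : MachineState) :
      Exec (.put a idx x) s (s.setArr a (idx.eval s) (x.eval s)) (idx.cost s + x.cost s + 1)
  | seq {P Q : MachineProg} {s s₁ s₂ : MachineState} {t₁ t₂ : ℕ} :
      Exec P s s₁ t₁ → Exec Q s₁ s₂ t₂ → Exec (.seq P Q) s s₂ (t₁ + t₂)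
  | iteTrue {test : MachineExpr} {P Q : MachineProg} {s s₁ : MachineState} {t : ℕ} :
      test.eval s ≠ 0 → Exec P s s₁ t → Exec (.ite test P Q) s s₁ (test.cost s + 1 + t)
  | iteFalse {test : MachineExpr} {P Q : MachineProg} {s s₁ : MachineState} {t : ℕ} :
      test.eval s = 0 → Exec Q s s₁ t → Exec (.ite test P Q) s s₁ (test.cost s + 1 + t)
  | whileTrue {test : MachineExpr} {P : MachineProg} {s s₁ s₂ : MachineState} {t₁ t₂ : ℕ} :
      test.eval s ≠ 0 → Exec P s s₁ t₁ → Exec (.while test P) s₁ s₂ t₂ →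
        Exec (.while test P) s s₂ (test.cost s + 1 + t₁ + t₂)
  | whileFalse {test : MachineExpr} {P : MachineProg} {s : MachineState} :
      test.eval s = 0 → Exec (.while test P) s s (test.cost s + 1)

/-- Programs are deterministic: the initial state determines the final state and the cost. -/
theorem MachineProg.Exec.deterministic {P : MachineProg} {s s₁ s₂ : MachineState} {t₁ t₂ : ℕ}
    (h₁ : P.Exec s s₁ t₁) (h₂ : P.Exec s s₂ t₂) : s₁ = s₂ ∧ t₁ = t₂ := by
  induction h₁ generalizing s₂ t₂ with
  | skip s => cases h₂; exact ⟨rfl, rfl⟩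
  | assign i x s => cases h₂; exact ⟨rfl, rfl⟩
  | put a idx x s => cases h₂; exact ⟨rfl, rfl⟩
  | seq _ _ ih₁ ih₂ =>
    cases h₂ with
    | seq h h' =>
      obtain ⟨rfl, rfl⟩ := ih₁ h
      obtain ⟨rfl, rfl⟩ := ih₂ h'
      exact ⟨rfl, rfl⟩
  | iteTrue hc _ ih =>
    cases h₂ with
    | iteTrue _ h => obtain ⟨rfl, rfl⟩ := ih h; exact ⟨rfl, rfl⟩
    | iteFalse hc' _ => exact absurd hc' hc
  | iteFalse hc _ ih =>
    cases h₂ with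
    | iteTrue hc' _ => exact absurd hc hc'
    | iteFalse _ h => obtain ⟨rfl, rfl⟩ := ih h; exact ⟨rfl, rfl⟩
  | whileTrue hc _ _ ih₁ ih₂ =>
    cases h₂ with
    | whileTrue _ h h' =>
      obtain ⟨rfl, rfl⟩ := ih₁ h
      obtain ⟨rfl, rfl⟩ := ih₂ h'
      exact ⟨rfl, rfl⟩
    | whileFalse hc' => exact absurd hc' hc
  | whileFalse hc =>
    cases h₂ with
    | whileTrue hc' _ _ => exact absurd hc hc'
    | whileFalse _ => exact ⟨rfl, rfl⟩

/-- The initial state on input `(d, A)`: `d` in register `0`, `A` in register `1`, and `0`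
everywhere else. -/
def inputState (d A : ℕ) : MachineState where
  reg := fun i => if i = 0 then d else if i = 1 then A else 0
  arr := fun _ _ => 0

/-! ### The digit polynomial and the Berlekamp–Hensel factorization -/

/-- The polynomial `∑ aᵢ Xⁱ` whose coefficients are the base-`A` digits `aᵢ` of `d`. -/
noncomputable def digitPoly (A d : ℕ) : ℤ[X] :=
  Nat.ofDigits (X : ℤ[X]) (Nat.digits A d)

/-- The successive results of the Berlekamp–Hensel method for a polynomial `g` of degree `k` that
is a product of factors `bᵢ X + 1` with `bᵢ < d`: a prime `q`, a complete factorization modulo `q`,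
its lift modulo `q ^ m`, and the coefficients `bᵢ` recovered from the lifted factors. -/
structure BerlekampHensel (g : ℤ[X]) (d k q m : ℕ) (β c b : ℕ → ℕ) : Prop where
  /-- `q` is the least prime not dividing the leading coefficient for which `g` is squarefree
  modulo `q`. -/
  prime : IsLeast {r : ℕ | r.Prime ∧ ¬ (r : ℤ) ∣ g.leadingCoeff ∧
    Squarefree (g.map (Int.castRingHom (ZMod r)))} q
  /-- The complete factorization into monic irreducible factors `X + βᵢ` modulo `q`. -/
  factor_lt : ∀ i < k, β i < q
  factor : g.map (Int.castRingHom (ZMod q)) =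
    C (g.leadingCoeff : ZMod q) * ∏ i ∈ Finset.range k, (X + C (β i : ZMod q))
  /-- The precision: `m = ⌈ln d / ln q⌉`. -/
  precision : m = Nat.clog q d
  /-- The lifted factorization into factors `X + cᵢ` modulo `q ^ m`, where `X + cᵢ` lifts
  `X + βᵢ`. -/
  lift_lt : ∀ i < k, c i < q ^ m
  lift_modEq : ∀ i < k, c i ≡ β i [MOD q]
  lift : g.map (Int.castRingHom (ZMod (q ^ m))) =
    C (g.leadingCoeff : ZMod (q ^ m)) * ∏ i ∈ Finset.range k, (X + C (c i : ZMod (q ^ m)))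
  /-- `bᵢ` is the inverse of `cᵢ` modulo `q ^ m`. -/
  inverse_lt : ∀ i < k, b i < q ^ m
  inverse : ∀ i < k, b i * c i ≡ 1 [MOD q ^ m]

/-! ### Running a program with bounded memory -/

/-! Arithmetic. Since `p i = b i * A + 1` is at least `A`, `d` is at least `A` to the sum of the
exponents. The hypothesis bounds `d` strictly by `A ^ (k + 1)`, so the sum is at most `k` and every
exponent is 1. Then `d` is at least `A ^ k * ∏ b i`, so the central binomial coefficient times `∏ b
i` is less than `A` (`exponents_eq_one`). Each coefficient of `∏ (b i X + 1)` is an elementary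
symmetric function of the `b i`, at most that product. Evaluation at `A` therefore involves no
carries, and the coefficients are the base-`A` digits of `d` (`digits_prod`).

Algorithm. The `b i` are distinct because the primes are. For a prime `r`, the polynomial `g` has
`k` roots modulo `r` exactly when the `b i` are distinct units modulo `r`, which is the condition
that `r` does not divide the leading coefficient and `g` is squarefree modulo `r`. Exhaustive search
over `r` and its residues thus finds `q` and the `β i`. Lifting is exhaustive too, one base-`q`
digit at a time: near one root all the other factors are units, so exactly one digit passes the test
(`exists_liftData`). Since `b i < d ≤ q ^ m`, inverting the lifted roots recovers the integers `b i`
themselves.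

Cost. Every prime below `q` divides the nonzero number `discriminantBound b`, which is at most `d ^
2`, so a Chebyshev bound gives `q = O(log d)`. Distinctness forces `2 ^ (k - 1) ≤ ∏ b i ≤ A`, and
with `A ^ k ≤ d` this gives `k ^ 2 = O(log d)`. The search takes `O(q² k)` steps and the lifting
`O(k² m q)`, hence `O((log d)³)` in all. Stored numbers are at most `d * q`, of length `O(log d)`,
and a step has quadratic bit cost, which gives `O((log d)⁵)`. The factor `(log log d)²` is not
needed for growth: it is bounded below for `d ≥ 3` and absorbed into the constant. -/

/-- All values held in the memory are at most `B`. -/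
def MachineState.BoundedBy (s : MachineState) (B : ℕ) : Prop :=
  (∀ i, s.reg i ≤ B) ∧ ∀ a i, s.arr a i ≤ B

theorem MachineState.BoundedBy.setReg {s : MachineState} {B i v : ℕ} (hs : s.BoundedBy B)
    (hv : v ≤ B) : (s.setReg i v).BoundedBy B := by
  refine ⟨fun j => ?_, hs.2⟩
  by_cases h : j = i
  · subst h; simpa [MachineState.setReg] using hv
  · simpa [MachineState.setReg, h] using hs.1 j

theorem MachineState.BoundedBy.setArr {s : MachineState} {B a j v : ℕ} (hs : s.BoundedBy B)
    (hv : v ≤ B) : (s.setArr a j v).BoundedBy B := by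
  refine ⟨hs.1, fun a₂ j₂ => ?_⟩
  by_cases h : a₂ = a
  · subst h
    by_cases hj : j₂ = j
    · subst hj; simpa [MachineState.setArr] using hv
    · simpa [MachineState.setArr, hj] using hs.2 a₂ j₂
  · simpa [MachineState.setArr, h] using hs.2 a₂ j₂

/-- `RunsTo B P s s' n`: the program `P` halts in `s'` after `n` assignments and tests, and every
value it stores is at most `B`. -/
inductive MachineProg.RunsTo (B : ℕ) :
    MachineProg → MachineState → MachineState → ℕ → Prop where
  | skip (s : MachineState) : RunsTo B .skip s s 1
  | assign (i : ℕ) (x : MachineExpr) (s : MachineState) (h : x.eval s ≤ B) :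
      RunsTo B (.assign i x) s (s.setReg i (x.eval s)) 1
  | put (a : ℕ) (idx x : MachineExpr) (s : MachineState) (h : x.eval s ≤ B) :
      RunsTo B (.put a idx x) s (s.setArr a (idx.eval s) (x.eval s)) 1
  | seq {P Q : MachineProg} {s s₁ s₂ : MachineState} {n₁ n₂ : ℕ} :
      RunsTo B P s s₁ n₁ → RunsTo B Q s₁ s₂ n₂ → RunsTo B (.seq P Q) s s₂ (n₁ + n₂)
  | iteTrue {test : MachineExpr} {P Q : MachineProg} {s s₁ : MachineState} {n : ℕ} :
      test.eval s ≠ 0 → RunsTo B P s s₁ n → RunsTo B (.ite test P Q) s s₁ (1 + n)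
  | iteFalse {test : MachineExpr} {P Q : MachineProg} {s s₁ : MachineState} {n : ℕ} :
      test.eval s = 0 → RunsTo B Q s s₁ n → RunsTo B (.ite test P Q) s s₁ (1 + n)
  | whileTrue {test : MachineExpr} {P : MachineProg} {s s₁ s₂ : MachineState} {n₁ n₂ : ℕ} :
      test.eval s ≠ 0 → RunsTo B P s s₁ n₁ → RunsTo B (.while test P) s₁ s₂ n₂ →
        RunsTo B (.while test P) s s₂ (1 + n₁ + n₂)
  | whileFalse {test : MachineExpr} {P : MachineProg} {s : MachineState} :
      test.eval s = 0 → RunsTo B (.while test P) s s 1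

theorem MachineProg.RunsTo.boundedBy {B : ℕ} {P : MachineProg} {s s' : MachineState} {n : ℕ}
    (h : P.RunsTo B s s' n) (hs : s.BoundedBy B) : s'.BoundedBy B := by
  induction h with
  | skip s => exact hs
  | assign i x s h => exact hs.setReg h
  | put a idx x s h => exact hs.setArr h
  | seq _ _ ih₁ ih₂ => exact ih₂ (ih₁ hs)
  | iteTrue _ _ ih => exact ih hs
  | iteFalse _ _ ih => exact ih hs
  | whileTrue _ _ _ ih₁ ih₂ => exact ih₂ (ih₁ hs)
  | whileFalse _ => exact hs

/-- Intermediate values may exceed `B`, but lengths are subadditive under products, subadditive up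
to 1 under sums, and not increased by the other arithmetic operations. A fixed expression thus loses
only a constant factor. -/
theorem MachineExpr.size_eval_le (x : MachineExpr) :
    ∃ c, ∀ (s : MachineState) (B : ℕ), 1 ≤ B → s.BoundedBy B →
      (x.eval s).size ≤ c * B.size := by
  have pos : ∀ B : ℕ, 1 ≤ B → 1 ≤ B.size := fun B hB => Nat.size_pos.2 hB
  have hadd : ∀ m n : ℕ, (m + n).size ≤ m.size + n.size + 1 := fun m n => by
    rw [Nat.size_le]
    have h1 := Nat.lt_size_self m
    have h2 := Nat.lt_size_self n
    have h3 : 2 ^ m.size ≤ 2 ^ (m.size + n.size) := Nat.pow_le_pow_right (by norm_num) (by omega)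
    have h4 : 2 ^ n.size ≤ 2 ^ (m.size + n.size) := Nat.pow_le_pow_right (by norm_num) (by omega)
    rw [pow_succ]
    omega
  have hmul : ∀ m n : ℕ, (m * n).size ≤ m.size + n.size := fun m n => by
    rw [Nat.size_le, pow_add]
    exact Nat.mul_lt_mul'' (Nat.lt_size_self m) (Nat.lt_size_self n)
  induction x with
  | const n => exact ⟨n.size, fun s B hB _ => Nat.le_mul_of_pos_right _ (pos B hB)⟩
  | reg i => exact ⟨1, fun s B _ hs => by rw [one_mul]; exact Nat.size_le_size (hs.1 i)⟩
  | get a idx _ => exact ⟨1, fun s B _ hs => by rw [one_mul]; exact Nat.size_le_size (hs.2 a _)⟩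
  | add x y hx hy =>
    obtain ⟨c, hc⟩ := hx
    obtain ⟨c', hc'⟩ := hy
    refine ⟨c + c' + 1, fun s B hB hs => (hadd _ _).trans ?_⟩
    have := hc s B hB hs
    have := hc' s B hB hs
    have := pos B hB
    rw [add_mul, add_mul]
    omega
  | sub x y hx hy =>
    obtain ⟨c, hc⟩ := hx
    exact ⟨c, fun s B hB hs => (Nat.size_le_size (Nat.sub_le _ _)).trans (hc s B hB hs)⟩
  | mul x y hx hy =>
    obtain ⟨c, hc⟩ := hx
    obtain ⟨c', hc'⟩ := hy
    refine ⟨c + c', fun s B hB hs => (hmul _ _).trans ?_⟩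
    have := hc s B hB hs
    have := hc' s B hB hs
    rw [add_mul]
    omega
  | div x y hx hy =>
    obtain ⟨c, hc⟩ := hx
    exact ⟨c, fun s B hB hs => (Nat.size_le_size (Nat.div_le_self _ _)).trans (hc s B hB hs)⟩
  | mod x y hx hy =>
    obtain ⟨c, hc⟩ := hx
    exact ⟨c, fun s B hB hs => (Nat.size_le_size (Nat.mod_le _ _)).trans (hc s B hB hs)⟩

theorem MachineExpr.cost_le (x : MachineExpr) :
    ∃ c, ∀ (s : MachineState) (B : ℕ), 1 ≤ B → s.BoundedBy B →
      x.cost s ≤ c * B.size ^ 2 := by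
  have lin : ∀ B n c : ℕ, 1 ≤ B → n ≤ c * B.size → n + 1 ≤ (c + 1) * B.size ^ 2 :=
    fun B n c hB h => by
      have := Nat.size_pos.2 hB
      nlinarith [Nat.zero_le c]
  have mulCase : ∀ x y : MachineExpr,
      (∃ c, ∀ (s : MachineState) (B : ℕ), 1 ≤ B → s.BoundedBy B → x.cost s ≤ c * B.size ^ 2) →
      (∃ c, ∀ (s : MachineState) (B : ℕ), 1 ≤ B → s.BoundedBy B → y.cost s ≤ c * B.size ^ 2) →
      ∃ c, ∀ (s : MachineState) (B : ℕ), 1 ≤ B → s.BoundedBy B →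
        x.cost s + y.cost s + ((x.eval s).size + 1) * ((y.eval s).size + 1) ≤
          c * B.size ^ 2 := by
    rintro x y ⟨c, hc⟩ ⟨c', hc'⟩
    obtain ⟨e, he⟩ := x.size_eval_le
    obtain ⟨e', he'⟩ := y.size_eval_le
    refine ⟨c + c' + (e + 1) * (e' + 1), fun s B hB hs => ?_⟩
    have h1 := hc s B hB hs
    have h2 := hc' s B hB hs
    have hp := Nat.size_pos.2 hB
    have h3 : (x.eval s).size + 1 ≤ (e + 1) * B.size := by nlinarith [he s B hB hs]
    have h4 : (y.eval s).size + 1 ≤ (e' + 1) * B.size := by nlinarith [he' s B hB hs]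
    calc _ ≤ c * B.size ^ 2 + c' * B.size ^ 2 + ((e + 1) * B.size) * ((e' + 1) * B.size) :=
          add_le_add (add_le_add h1 h2) (Nat.mul_le_mul h3 h4)
      _ = _ := by ring
  -- The linear charge for sums is dominated by the product charge, so sums and differences inherit
  -- the bound for products.
  have addCase : ∀ x y : MachineExpr,
      (∃ c, ∀ (s : MachineState) (B : ℕ), 1 ≤ B → s.BoundedBy B →
        x.cost s + y.cost s + ((x.eval s).size + 1) * ((y.eval s).size + 1) ≤
          c * B.size ^ 2) →
      ∃ c, ∀ (s : MachineState) (B : ℕ), 1 ≤ B → s.BoundedBy B →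
        x.cost s + y.cost s + ((x.eval s).size + (y.eval s).size + 1) ≤ c * B.size ^ 2 := by
    rintro x y ⟨c, hc⟩
    refine ⟨c, fun s B hB hs => le_trans ?_ (hc s B hB hs)⟩
    gcongr
    nlinarith [Nat.zero_le ((x.eval s).size * (y.eval s).size)]
  induction x with
  | const n =>
    exact ⟨n.size + 1, fun s B hB hs =>
      lin B _ _ hB (Nat.le_mul_of_pos_right _ (Nat.size_pos.2 hB))⟩
  | reg i =>
    exact ⟨1 + 1, fun s B hB hs => lin B _ _ hB (by simpa using Nat.size_le_size (hs.1 i))⟩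
  | get a idx h =>
    obtain ⟨c, hc⟩ := h
    obtain ⟨e, he⟩ := idx.size_eval_le
    refine ⟨c + (e + 1 + 1), fun s B hB hs => ?_⟩
    have h1 := hc s B hB hs
    have h2 : (s.arr a (idx.eval s)).size ≤ B.size := Nat.size_le_size (hs.2 a _)
    have h3 := lin B ((idx.eval s).size + (s.arr a (idx.eval s)).size) (e + 1) hB
      (by rw [add_mul, one_mul]; exact add_le_add (he s B hB hs) h2)
    rw [add_mul]
    show idx.cost s + _ + _ + 1 ≤ _
    omega
  | add x y hx hy => exact addCase x y (mulCase x y hx hy)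
  | sub x y hx hy => exact addCase x y (mulCase x y hx hy)
  | mul x y hx hy => exact mulCase x y hx hy
  | div x y hx hy => exact mulCase x y hx hy
  | mod x y hx hy => exact mulCase x y hx hy

/-- With memory bounded by `B`, every step of a fixed program costs `O((log B)²)`. -/
theorem MachineProg.exists_exec_of_runsTo (P : MachineProg) :
    ∃ c, ∀ (B : ℕ) (s s' : MachineState) (n : ℕ), 1 ≤ B → s.BoundedBy B → P.RunsTo B s s' n →
      ∃ t, P.Exec s s' t ∧ t ≤ c * n * B.size ^ 2 := by
  have one : ∀ B : ℕ, 1 ≤ B → 1 ≤ B.size ^ 2 := fun B hB =>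
    Nat.one_le_pow _ _ (Nat.size_pos.2 hB)
  induction P with
  | skip =>
    refine ⟨1, fun B s s' n hB hs h => ?_⟩
    cases h
    exact ⟨1, .skip s, by simpa using one B hB⟩
  | assign i x =>
    obtain ⟨c, hc⟩ := x.cost_le
    refine ⟨c + 1, fun B s s' n hB hs h => ?_⟩
    cases h
    refine ⟨_, .assign i x s, ?_⟩
    have := hc s B hB hs
    have := one B hB
    rw [mul_one, add_mul]
    omega
  | put a idx x =>
    obtain ⟨c, hc⟩ := x.cost_le
    obtain ⟨c', hc'⟩ := idx.cost_le
    refine ⟨c' + c + 1, fun B s s' n hB hs h => ?_⟩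
    cases h
    refine ⟨_, .put a idx x s, ?_⟩
    have := hc s B hB hs
    have := hc' s B hB hs
    have := one B hB
    rw [mul_one, add_mul, add_mul]
    omega
  | seq P Q hP hQ =>
    obtain ⟨c, hc⟩ := hP
    obtain ⟨c', hc'⟩ := hQ
    refine ⟨c + c', fun B s s' n hB hs h => ?_⟩
    cases h with
    | @seq _ _ _ s₁ _ n₁ n₂ h₁ h₂ =>
      obtain ⟨t₁, e₁, b₁⟩ := hc B _ _ _ hB hs h₁
      obtain ⟨t₂, e₂, b₂⟩ := hc' B _ _ _ hB (h₁.boundedBy hs) h₂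
      refine ⟨_, .seq e₁ e₂, (add_le_add b₁ b₂).trans ?_⟩
      rw [← add_mul]
      gcongr
      nlinarith [Nat.zero_le (c * n₂), Nat.zero_le (c' * n₁)]
  | ite test P Q hP hQ =>
    obtain ⟨e, he⟩ := test.cost_le
    obtain ⟨c, hc⟩ := hP
    obtain ⟨c', hc'⟩ := hQ
    refine ⟨e + 1 + c + c', fun B s s' n hB hs h => ?_⟩
    have h1 := he s B hB hs
    have h2 := one B hB
    cases h with
    | @iteTrue _ _ _ _ _ n ht h =>
      obtain ⟨t, ht', hb⟩ := hc B _ _ _ hB hs h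
      refine ⟨_, .iteTrue ht ht', ?_⟩
      calc _ ≤ e * B.size ^ 2 + B.size ^ 2 + c * n * B.size ^ 2 := by omega
        _ = (e + 1 + c * n) * B.size ^ 2 := by ring
        _ ≤ _ := by gcongr; nlinarith [Nat.zero_le (e * n), Nat.zero_le (c' * n)]
    | @iteFalse _ _ _ _ _ n ht h =>
      obtain ⟨t, ht', hb⟩ := hc' B _ _ _ hB hs h
      refine ⟨_, .iteFalse ht ht', ?_⟩
      calc _ ≤ e * B.size ^ 2 + B.size ^ 2 + c' * n * B.size ^ 2 := by omega
        _ = (e + 1 + c' * n) * B.size ^ 2 := by ring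
        _ ≤ _ := by gcongr; nlinarith [Nat.zero_le (e * n), Nat.zero_le (c * n)]
  | _ test P hP =>
    obtain ⟨e, he⟩ := test.cost_le
    obtain ⟨c, hc⟩ := hP
    refine ⟨e + 1 + c, fun B s s' n hB hs h => ?_⟩
    -- A loop reappears in its own execution rule, so the induction here is on the run; for this the
    -- program index must be a variable.
    generalize hW : MachineProg.while test P = W at h
    induction h with
    | skip | assign | put | seq | iteTrue | iteFalse => cases hW
    | @whileTrue test' P' s s₁ s₂ n₁ n₂ ht h₁ h₂ _ ih =>
      cases hW
      obtain ⟨t₁, e₁, b₁⟩ := hc B _ _ _ hB hs h₁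
      obtain ⟨t₂, e₂, b₂⟩ := ih (h₁.boundedBy hs) rfl
      refine ⟨_, .whileTrue ht e₁ e₂, ?_⟩
      have h1 := he s B hB hs
      have h2 := one B hB
      calc _ ≤ e * B.size ^ 2 + B.size ^ 2 + c * n₁ * B.size ^ 2
            + (e + 1 + c) * n₂ * B.size ^ 2 := by omega
        _ = (e + 1 + c * n₁ + (e + 1 + c) * n₂) * B.size ^ 2 := by ring
        _ ≤ _ := by gcongr; nlinarith [Nat.zero_le (e * n₁)]
    | @whileFalse test' P' s ht =>
      cases hW
      refine ⟨_, .whileFalse ht, ?_⟩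
      have h1 := he s B hB hs
      have h2 := one B hB
      calc _ ≤ e * B.size ^ 2 + B.size ^ 2 := by omega
        _ = (e + 1) * B.size ^ 2 := by ring
        _ ≤ _ := by gcongr; omega

/-! ### Total correctness with a step count -/

/-- Started in `s`, the program `P` halts within `n` steps in a state satisfying `Q`, storing only
values at most `B`. -/
def MachineProg.Ensures (B : ℕ) (P : MachineProg) (s : MachineState) (n : ℕ)
    (Q : MachineState → Prop) : Prop :=
  ∃ s' n', P.RunsTo B s s' n' ∧ n' ≤ n ∧ Q s'

namespace MachineProg.Ensures

variable {B : ℕ} {P P₁ P₂ : MachineProg} {s : MachineState} {n n₁ n₂ : ℕ}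
  {Q R : MachineState → Prop}

theorem mono (h : P.Ensures B s n₁ R) (hn : n₁ ≤ n) (hQ : ∀ s', R s' → Q s') :
    P.Ensures B s n Q := by
  obtain ⟨s', m, hr, hm, hR⟩ := h
  exact ⟨s', m, hr, hm.trans hn, hQ s' hR⟩

theorem skip (h : Q s) : MachineProg.skip.Ensures B s 1 Q :=
  ⟨s, 1, .skip s, le_rfl, h⟩

theorem assign {i : ℕ} {x : MachineExpr} (hB : x.eval s ≤ B) (h : Q (s.setReg i (x.eval s))) :
    (MachineProg.assign i x).Ensures B s 1 Q :=
  ⟨_, 1, .assign i x s hB, le_rfl, h⟩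

theorem put {a : ℕ} {idx x : MachineExpr} (hB : x.eval s ≤ B)
    (h : Q (s.setArr a (idx.eval s) (x.eval s))) :
    (MachineProg.put a idx x).Ensures B s 1 Q :=
  ⟨_, 1, .put a idx x s hB, le_rfl, h⟩

theorem seq (h₁ : P₁.Ensures B s n₁ R) (h₂ : ∀ s', R s' → P₂.Ensures B s' n₂ Q) :
    (MachineProg.seq P₁ P₂).Ensures B s (n₁ + n₂) Q := by
  obtain ⟨s', m, hr, hm, hR⟩ := h₁
  obtain ⟨s'', m', hr', hm', hQ⟩ := h₂ s' hR
  exact ⟨s'', _, .seq hr hr', by omega, hQ⟩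

theorem assign_seq {i : ℕ} {x : MachineExpr} (hB : x.eval s ≤ B)
    (h : P.Ensures B (s.setReg i (x.eval s)) n Q) :
    (MachineProg.seq (.assign i x) P).Ensures B s (n + 1) Q := by
  rw [add_comm]
  exact seq (R := fun s' => s' = s.setReg i (x.eval s)) (assign hB rfl) (by rintro _ rfl; exact h)

theorem put_seq {a : ℕ} {idx x : MachineExpr} (hB : x.eval s ≤ B)
    (h : P.Ensures B (s.setArr a (idx.eval s) (x.eval s)) n Q) :
    (MachineProg.seq (.put a idx x) P).Ensures B s (n + 1) Q := by
  rw [add_comm]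
  exact seq (R := fun s' => s' = s.setArr a (idx.eval s) (x.eval s)) (put hB rfl)
    (by rintro _ rfl; exact h)

theorem ite {test : MachineExpr} (h₁ : test.eval s ≠ 0 → P₁.Ensures B s n Q)
    (h₂ : test.eval s = 0 → P₂.Ensures B s n Q) :
    (MachineProg.ite test P₁ P₂).Ensures B s (n + 1) Q := by
  by_cases ht : test.eval s = 0
  · obtain ⟨s', m, hr, hm, hQ⟩ := h₂ ht
    exact ⟨s', _, .iteFalse ht hr, by omega, hQ⟩
  · obtain ⟨s', m, hr, hm, hQ⟩ := h₁ ht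
    exact ⟨s', _, .iteTrue ht hr, by omega, hQ⟩

/-- A loop that runs `N` times, with an invariant indexed by the number of completed rounds. -/
theorem loop {test : MachineExpr} (I : ℕ → MachineState → Prop) (N : ℕ) (h0 : I 0 s)
    (hstep : ∀ i s', i < N → I i s' → test.eval s' ≠ 0 ∧ P.Ensures B s' n (I (i + 1)))
    (hend : ∀ s', I N s' → test.eval s' = 0) :
    (MachineProg.while test P).Ensures B s (N * (n + 1) + 1) (I N) := by
  have key : ∀ r i s', i + r = N → I i s' →
      (MachineProg.while test P).Ensures B s' (r * (n + 1) + 1) (I N) := by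
    intro r
    induction r with
    | zero =>
      rintro i s' rfl hI
      exact ⟨s', 1, .whileFalse (hend s' hI), by omega, hI⟩
    | succ r ih =>
      rintro i s' hi hI
      obtain ⟨ht, s₁, m, hr, hm, hI₁⟩ := hstep i s' (by omega) hI
      obtain ⟨s₂, m', hr', hm', hI₂⟩ := ih (i + 1) s₁ (by omega) hI₁
      exact ⟨s₂, _, .whileTrue ht hr hr', by rw [add_mul]; omega, hI₂⟩
  exact key N 0 s (by omega) h0

end MachineProg.Ensures

/-! ### The program -/

attribute [simp] MachineExpr.eval

@[simp] theorem MachineState.setReg_reg (s : MachineState) (i v j : ℕ) :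
    (s.setReg i v).reg j = if j = i then v else s.reg j := by
  simp [MachineState.setReg, Function.update_apply]

@[simp] theorem MachineState.setReg_arr (s : MachineState) (i v : ℕ) :
    (s.setReg i v).arr = s.arr := rfl

@[simp] theorem MachineState.setArr_reg (s : MachineState) (a i v : ℕ) :
    (s.setArr a i v).reg = s.reg := rfl

@[simp] theorem MachineState.setArr_arr (s : MachineState) (a i v b j : ℕ) :
    (s.setArr a i v).arr b j = if b = a ∧ j = i then v else s.arr b j := by
  by_cases h : b = a
  · subst h; simp [MachineState.setArr, Function.update_apply]
  · simp [MachineState.setArr, h]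

namespace BHProg

open MachineExpr MachineProg

/-- Write the base-`reg 1` digits of `reg 0` into array `3` and the degree into `reg 3`. -/
def digits : MachineProg :=
  .seq (.assign 4 (.reg 0)) <|
  .seq (.assign 3 (.const 0)) <|
  .seq (.while (.reg 4) <|
    .seq (.put 3 (.reg 3) (.mod (.reg 4) (.reg 1))) <|
    .seq (.assign 4 (.div (.reg 4) (.reg 1))) <|
    .assign 3 (.add (.reg 3) (.const 1))) <|
  .assign 3 (.sub (.reg 3) (.const 1))

/-- Horner evaluation: `reg 23` receives the value at `-reg 21` modulo `reg 20`. -/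
def horner : MachineProg :=
  .seq (.assign 22 (.add (.reg 3) (.const 1))) <|
  .seq (.assign 23 (.const 0)) <|
  .while (.reg 22) <|
    .seq (.assign 22 (.sub (.reg 22) (.const 1))) <|
    .assign 23 (.mod (.add (.mul (.reg 23) (.sub (.reg 20) (.reg 21))) (.get 3 (.reg 22)))
      (.reg 20))

/-- List in array `0` the negated roots modulo `reg 5`, count them in `reg 11`, and count in
`reg 12` the proper divisors of `reg 5`. -/
def scan : MachineProg :=
  .seq (.assign 10 (.const 0)) <|
  .seq (.assign 11 (.const 0)) <|
  .seq (.assign 12 (.const 0)) <|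
  .seq (.assign 20 (.reg 5)) <|
  .while (.sub (.reg 5) (.reg 10)) <|
    .seq (.assign 21 (.reg 10)) <|
    .seq horner <|
    .seq (.ite (.reg 23) .skip
      (.seq (.put 0 (.reg 11) (.reg 10)) (.assign 11 (.add (.reg 11) (.const 1))))) <|
    .seq (.ite (.mod (.reg 5) (.reg 10)) .skip (.assign 12 (.add (.reg 12) (.const 1)))) <|
    .assign 10 (.add (.reg 10) (.const 1))

/-- Search in `reg 5` for the least prime modulo which there are `reg 3` roots. -/
def findPrime : MachineProg :=
  .seq (.assign 5 (.const 1)) <|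
  .seq (.assign 6 (.const 0)) <|
  .while (.sub (.const 1) (.reg 6)) <|
    .seq (.assign 5 (.add (.reg 5) (.const 1))) <|
    .seq scan <|
    .assign 6 (.sub (.const 1) (.add (.add (.sub (.reg 11) (.reg 3)) (.sub (.reg 3) (.reg 11)))
      (.sub (.reg 12) (.const 1))))

/-- The precision `reg 2` and the modulus `reg 7`. -/
def precision : MachineProg :=
  .seq (.assign 2 (.const 0)) <|
  .seq (.assign 7 (.const 1)) <|
  .while (.sub (.reg 0) (.reg 7)) <|
    .seq (.assign 7 (.mul (.reg 7) (.reg 5))) <|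
    .assign 2 (.add (.reg 2) (.const 1))

/-- Lift `reg 21` from the modulus `reg 16` to the modulus `reg 7` one digit at a time, where
`test` decides if `reg 21` is correct modulo `reg 20`. -/
def lift (test : MachineProg) : MachineProg :=
  .while (.sub (.reg 7) (.reg 16)) <|
    .seq (.assign 20 (.mul (.reg 16) (.reg 5))) <|
    .seq test <|
    .seq (.while (.reg 23) <|
      .seq (.assign 21 (.add (.reg 21) (.reg 16))) test) <|
    .assign 16 (.reg 20)

/-- Decide if `reg 21` is the inverse of `reg 15` modulo `reg 20`. -/
def inverseTest : MachineProg :=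
  .assign 23 (.mod (.add (.mul (.reg 21) (.reg 15)) (.sub (.reg 20) (.const 1))) (.reg 20))

/-- Lift all roots into array `1` and write their inverses into array `2`. -/
def liftAll : MachineProg :=
  .seq (.assign 8 (.const 0)) <|
  .while (.sub (.reg 3) (.reg 8)) <|
    .seq (.assign 21 (.get 0 (.reg 8))) <|
    .seq (.assign 16 (.reg 5)) <|
    .seq (lift horner) <|
    .seq (.put 1 (.reg 8) (.reg 21)) <|
    .seq (.assign 15 (.reg 21)) <|
    .seq (.assign 21 (.const 0)) <|
    .seq (.assign 16 (.const 1)) <|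
    .seq (lift inverseTest) <|
    .seq (.put 2 (.reg 8) (.reg 21)) <|
    .assign 8 (.add (.reg 8) (.const 1))

/-- The whole program. -/
def main : MachineProg :=
  .seq digits <| .seq findPrime <| .seq precision <| .seq liftAll <|
  .seq (.assign 0 (.reg 3)) (.assign 1 (.reg 5))

/-- The registers below `m` agree. -/
def RegEq (m : ℕ) (s s' : MachineState) : Prop := ∀ j < m, s'.reg j = s.reg j

/-! ### Correctness and step counts of the phases -/

variable {B k A d q m : ℕ} {s : MachineState}

/-- The degree and the digits are in place. -/
structure HasDigits (A d k : ℕ) (s : MachineState) : Prop where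
  reg : s.reg 3 = k
  arr : ∀ j ≤ k, s.arr 3 j = d / A ^ j % A

theorem ofDigits_digits_step (hA : 2 ≤ A) (y n : ℕ) :
    Nat.ofDigits y (Nat.digits A n) =
      n % A + y * Nat.ofDigits y (Nat.digits A (n / A)) := by
  rcases Nat.eq_zero_or_pos n with rfl | hn
  · simp
  · rw [Nat.digits_def' hA hn, Nat.ofDigits_cons]

theorem digits_ensures (hA : 2 ≤ A) (hlo : A ^ k ≤ d) (hhi : d < A ^ (k + 1)) (hdB : d ≤ B)
    (hkB : k + 1 ≤ B) (h0 : s.reg 0 = d) (h1 : s.reg 1 = A) :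
    digits.Ensures B s (4 * k + 8) fun s' => HasDigits A d k s' ∧ RegEq 3 s s' := by
  unfold digits
  refine .mono (n₁ := ((k + 1) * (3 + 1) + 1 + 1) + 1 + 1) ?_ (by omega) fun _ h => h
  refine .assign_seq (by simpa [h0] using hdB) ?_
  refine .assign_seq (by simp) ?_
  refine .seq (n₁ := (k + 1) * (3 + 1) + 1) (n₂ := 1)
    (.loop (fun i s' => s'.reg 3 = i ∧ s'.reg 4 = d / A ^ i ∧
    (∀ j < i, s'.arr 3 j = d / A ^ j % A) ∧ RegEq 3 s s') (k + 1) ?_ ?_ ?_) ?_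
  · refine ⟨by simp, by simp [h0],
      by simp, fun j hj => ?_⟩
    simp [show j ≠ 3 by omega, show j ≠ 4 by omega]
  · rintro i s' hi ⟨e3, e4, ha, hr⟩
    have e1 : s'.reg 1 = A := by rw [hr 1 (by omega), h1]
    have hpos : 0 < d / A ^ i :=
      Nat.div_pos ((Nat.pow_le_pow_right (by omega) (by omega)).trans hlo) (by positivity)
    have hle : d / A ^ i ≤ B := (Nat.div_le_self _ _).trans hdB
    refine ⟨by simpa [e4] using hpos.ne', ?_⟩
    refine .put_seq (n := 2) ?_ (.assign_seq (n := 1) ?_ (.assign ?_ ⟨?_, ?_, ?_, ?_⟩))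
    · simpa [e4, e1] using (Nat.mod_le _ _).trans hle
    · simpa [e4, e1] using (Nat.div_le_self _ _).trans hle
    · simp [e3]; omega
    · simp [e3]
    · simp [e4, e1, pow_succ,
        Nat.div_div_eq_div_mul]
    · intro j hj
      simp only [MachineState.setReg_arr, MachineState.setArr_arr, MachineExpr.eval, e3, e4,
        e1, true_and]
      split_ifs with h
      · rw [h]
      · exact ha j (by omega)
    · intro j hj
      simpa [show j ≠ 3 by omega,
        show j ≠ 4 by omega] using hr j hj
  · rintro s' ⟨_, e4, _⟩
    simpa [e4] using Or.inr hhi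
  · rintro s' ⟨e3, e4, ha, hr⟩
    refine .assign ?_ ⟨⟨?_, ?_⟩, ?_⟩
    · simp [e3]; omega
    · simp [e3]
    · intro j hj
      exact ha j (by omega)
    · intro j hj
      simpa [show j ≠ 3 by omega] using hr j hj

/-- Digits are consumed from the top. After `i` rounds the accumulator is the value of the
polynomial whose coefficients are the digits of `d / A ^ (k + 1 - i)`, and one more digit is one use
of `ofDigits_digits_step`. -/
theorem horner_ensures {M x : ℕ} (hA : 2 ≤ A) (hhi : d < A ^ (k + 1)) (hkB : k + 1 ≤ B)
    (hs : HasDigits A d k s) (hM : 0 < M) (hMB : M ≤ B) (h20 : s.reg 20 = M)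
    (h21 : s.reg 21 = x) :
    horner.Ensures B s (3 * k + 6) fun s' => RegEq 22 s s' ∧ s'.arr = s.arr ∧
      s'.reg 23 = Nat.ofDigits (M - x) (Nat.digits A d) % M := by
  unfold horner
  -- The postcondition is the loop invariant at its last round verbatim, hence the unsimplified `k +
  -- 1 - (k + 1)`.
  refine .mono (n₁ := ((k + 1) * (2 + 1) + 1) + 1 + 1)
    (R := fun s' => s'.reg 22 = k + 1 - (k + 1) ∧ s'.reg 23 =
      Nat.ofDigits (M - x) (Nat.digits A (d / A ^ (k + 1 - (k + 1)))) % M ∧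
      RegEq 22 s s' ∧ s'.arr = s.arr) ?_ (by omega)
    fun s' h => ⟨h.2.2.1, h.2.2.2, by simpa using h.2.1⟩
  refine .assign_seq (by simpa [hs.reg] using hkB) ?_
  refine .assign_seq (by simp) ?_
  refine .loop (fun i s' => s'.reg 22 = k + 1 - i ∧ s'.reg 23 =
      Nat.ofDigits (M - x) (Nat.digits A (d / A ^ (k + 1 - i))) % M ∧
      RegEq 22 s s' ∧ s'.arr = s.arr) (k + 1) ?_ ?_ ?_
  · refine ⟨by simp [hs.reg], ?_, fun j hj => ?_, rfl⟩
    · simp [Nat.div_eq_of_lt hhi]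
    · simp [show j ≠ 22 by omega, show j ≠ 23 by omega]
  · rintro i s' hi ⟨e22, e23, hr, ha⟩
    have e20 : s'.reg 20 = M := by rw [hr 20 (by omega), h20]
    have e21 : s'.reg 21 = x := by rw [hr 21 (by omega), h21]
    refine ⟨by simp [e22]; omega, ?_⟩
    refine .assign_seq (n := 1) ?_ (.assign ?_ ⟨?_, ?_, ?_, ?_⟩)
    · simp [e22]; omega
    · simpa [e20] using (Nat.mod_lt _ hM).le.trans hMB
    · simp [e22]; omega
    · have hj : s.arr 3 (k + 1 - i - 1) = d / A ^ (k + 1 - (i + 1)) % A := by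
        rw [hs.arr _ (by omega)]; congr 3
      have hdiv : d / A ^ (k + 1 - (i + 1)) / A = d / A ^ (k + 1 - i) := by
        rw [Nat.div_div_eq_div_mul, ← pow_succ]; congr 2; omega
      rw [ofDigits_digits_step hA _ (d / A ^ (k + 1 - (i + 1))), hdiv]
      simp only [MachineExpr.eval, MachineState.setReg_reg, MachineState.setReg_arr, e22, e23, e20,
        e21, ha, Nat.reduceEqDiff, reduceIte, hj]
      rw [add_comm, mul_comm, Nat.add_mod, Nat.mul_mod_mod, ← Nat.add_mod]
    · intro j hj
      simpa [show j ≠ 22 by omega, show j ≠ 23 by omega] using hr j hj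
    · exact ha
  · rintro s' ⟨e22, _⟩
    simp [e22]

theorem HasDigits.congr {s' : MachineState} (hs : HasDigits A d k s) (h3 : s'.reg 3 = s.reg 3)
    (ha : s'.arr 3 = s.arr 3) : HasDigits A d k s' :=
  ⟨h3.trans hs.reg, fun j hj => by rw [ha, hs.arr j hj]⟩

/-- The polynomial with coefficients the base-`A` digits of `d` vanishes at `-x` modulo `r`. -/
def NegRoot (A d r x : ℕ) : Prop := r ∣ Nat.ofDigits (r - x) (Nat.digits A d)

instance (A d r : ℕ) : DecidablePred (NegRoot A d r) := fun x =>
  inferInstanceAs (Decidable (r ∣ Nat.ofDigits (r - x) (Nat.digits A d)))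

/-- A root `x` is stored at the index counting the roots below it, so the array lists the roots in
increasing order, as `Nat.nth` does. -/
theorem scan_ensures {r : ℕ} (hA : 2 ≤ A) (hhi : d < A ^ (k + 1)) (hkB : k + 1 ≤ B)
    (hs : HasDigits A d k s) (hr : 0 < r) (hrB : r ≤ B) (h5 : s.reg 5 = r) :
    scan.Ensures B s (r * (3 * k + 14) + 5) fun s' => RegEq 10 s s' ∧
      (∀ a ≠ 0, s'.arr a = s.arr a) ∧ s'.reg 11 = Nat.count (NegRoot A d r) r ∧
      s'.reg 12 = Nat.count (· ∣ r) r ∧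
      ∀ x < r, NegRoot A d r x → s'.arr 0 (Nat.count (NegRoot A d r) x) = x := by
  unfold scan
  refine .mono (n₁ := (r * (3 * k + 13 + 1) + 1) + 1 + 1 + 1 + 1)
    (R := fun s' => s'.reg 10 = r ∧ RegEq 10 s s' ∧ s'.reg 20 = r ∧
      (∀ a ≠ 0, s'.arr a = s.arr a) ∧ s'.reg 11 = Nat.count (NegRoot A d r) r ∧
      s'.reg 12 = Nat.count (· ∣ r) r ∧
      ∀ x < r, NegRoot A d r x → s'.arr 0 (Nat.count (NegRoot A d r) x) = x) ?_
    (by rw [show 3 * k + 13 + 1 = 3 * k + 14 from rfl]) fun s' h => ⟨h.2.1, h.2.2.2⟩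
  refine .assign_seq (by simp) (.assign_seq (by simp) (.assign_seq (by simp) (.assign_seq
    (by simpa [h5] using hrB) ?_)))
  refine .loop (fun i s' => s'.reg 10 = i ∧ RegEq 10 s s' ∧ s'.reg 20 = r ∧
      (∀ a ≠ 0, s'.arr a = s.arr a) ∧ s'.reg 11 = Nat.count (NegRoot A d r) i ∧
      s'.reg 12 = Nat.count (· ∣ r) i ∧
      ∀ x < i, NegRoot A d r x → s'.arr 0 (Nat.count (NegRoot A d r) x) = x) r ?_ ?_ ?_
  · refine ⟨by simp, fun j hj => ?_, by simp [h5], by simp, by simp, by simp, by simp⟩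
    simp [show j ≠ 10 by omega, show j ≠ 11 by omega, show j ≠ 12 by omega,
      show j ≠ 20 by omega]
  · rintro i s₁ hi ⟨e10, hreg, e20, harr, e11, e12, henum⟩
    have e5 : s₁.reg 5 = r := by rw [hreg 5 (by omega), h5]
    have hci : Nat.count (NegRoot A d r) i ≤ i := Nat.count_le _
    have hdi : Nat.count (· ∣ r) i ≤ i := Nat.count_le _
    refine ⟨by simp [e5, e10]; omega, ?_⟩
    refine .mono (n₁ := (3 * k + 6) + ((2 + 1) + ((1 + 1) + 1)) + 1) ?_ (by omega) fun _ h => h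
    refine .assign_seq (by simp [e10]; omega) ?_
    refine .seq (n₁ := 3 * k + 6) (n₂ := (2 + 1) + ((1 + 1) + 1))
      (horner_ensures hA hhi hkB (x := i) (hs.congr ?_ ?_) hr hrB ?_ ?_) ?_
    · simpa using hreg 3 (by omega)
    · simpa using harr 3 (by omega)
    · simpa using e20
    · simpa using e10
    rintro s₂ ⟨hreg₂, harr₂, e23⟩
    simp only [MachineState.setReg_arr] at harr₂
    have f10 : s₂.reg 10 = i := by rw [hreg₂ 10 (by omega)]; simpa using e10
    have f11 : s₂.reg 11 = Nat.count (NegRoot A d r) i := by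
      rw [hreg₂ 11 (by omega)]; simpa using e11
    refine .seq (n₁ := 2 + 1) (n₂ := (1 + 1) + 1)
      (R := fun s' => s'.reg 10 = i ∧ RegEq 10 s s' ∧ s'.reg 20 = r ∧
      (∀ a ≠ 0, s'.arr a = s.arr a) ∧ s'.reg 11 = Nat.count (NegRoot A d r) (i + 1) ∧
      s'.reg 12 = Nat.count (· ∣ r) i ∧
      ∀ x < i + 1, NegRoot A d r x → s'.arr 0 (Nat.count (NegRoot A d r) x) = x)
      (.ite ?_ ?_) ?_
    · intro h23
      have hnot : ¬ NegRoot A d r i := by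
        simp only [MachineExpr.eval, e23] at h23
        exact fun h => h23 (Nat.mod_eq_zero_of_dvd h)
      refine .mono (.skip ⟨f10, fun j hj => ?_, ?_, ?_, ?_, ?_, ?_⟩) (by omega) fun _ h => h
      · rw [hreg₂ j (by omega), ← hreg j hj]; simp [show j ≠ 21 by omega]
      · rw [hreg₂ 20 (by omega)]; simpa using e20
      · rw [harr₂]; exact harr
      · rw [f11, Nat.count_succ, if_neg hnot, add_zero]
      · rw [hreg₂ 12 (by omega)]; simpa using e12
      · intro x hx hn
        rw [harr₂]
        refine henum x ?_ hn
        rcases Nat.lt_succ_iff_lt_or_eq.1 hx with h | rfl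
        · exact h
        · exact absurd hn hnot
    · intro h23
      have hroot : NegRoot A d r i := by
        simp only [MachineExpr.eval, e23] at h23
        exact Nat.dvd_of_mod_eq_zero h23
      refine .put_seq (n := 1) (by simp [f10]; omega) (.assign ?_ ⟨?_, fun j hj => ?_, ?_,
        fun a ha => ?_, ?_, ?_, ?_⟩)
      · simp [f11]; omega
      · simpa using f10
      · simp [show j ≠ 11 by omega]
        rw [hreg₂ j (by omega), ← hreg j hj]; simp [show j ≠ 21 by omega]
      · simp; rw [hreg₂ 20 (by omega)]; simpa using e20
      · funext j
        simp [ha, harr₂, harr a ha]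
      · simp [f11, Nat.count_succ, hroot]
      · simp; rw [hreg₂ 12 (by omega)]; simpa using e12
      · intro x hx hn
        rcases Nat.lt_succ_iff_lt_or_eq.1 hx with h | rfl
        · have : Nat.count (NegRoot A d r) x < Nat.count (NegRoot A d r) i :=
            Nat.count_strict_mono hn h
          simpa [f11, this.ne, harr₂] using henum x h hn
        · simp [f11, f10]
    · rintro s₃ ⟨g10, hreg₃, g20, harr₃, g11, g12, henum₃⟩
      have g5 : s₃.reg 5 = r := by rw [hreg₃ 5 (by omega), h5]
      refine .seq (n₁ := 1 + 1) (n₂ := 1)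
        (R := fun s' => s'.reg 10 = i ∧ RegEq 10 s s' ∧ s'.reg 20 = r ∧
        (∀ a ≠ 0, s'.arr a = s.arr a) ∧ s'.reg 11 = Nat.count (NegRoot A d r) (i + 1) ∧
        s'.reg 12 = Nat.count (· ∣ r) (i + 1) ∧
        ∀ x < i + 1, NegRoot A d r x → s'.arr 0 (Nat.count (NegRoot A d r) x) = x)
        (.ite ?_ ?_) ?_
      -- The candidate divisor `i = 0` needs no exception: `r % 0 = r` is nonzero and `0` does not
      -- divide `r`.
      · intro ht
        have hnot : ¬ i ∣ r := by
          simp only [MachineExpr.eval, g5, g10] at ht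
          exact fun h => ht (Nat.mod_eq_zero_of_dvd h)
        exact .skip ⟨g10, hreg₃, g20, harr₃, g11, by simp [g12, Nat.count_succ, hnot], henum₃⟩
      · intro ht
        have hdvd : i ∣ r := by
          simp only [MachineExpr.eval, g5, g10] at ht
          exact Nat.dvd_of_mod_eq_zero ht
        refine .assign (by simp [g12]; omega) ⟨by simpa using g10, fun j hj => ?_,
          by simpa using g20, harr₃, by simpa using g11,
          by simp [g12, Nat.count_succ, hdvd], henum₃⟩
        simpa [show j ≠ 12 by omega] using hreg₃ j hj
      · rintro s₄ ⟨k10, hreg₄, k20, harr₄, k11, k12, henum₄⟩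
        refine .assign (by simp [k10]; omega) ⟨by simp [k10], fun j hj => ?_,
          by simpa using k20, harr₄, by simpa using k11, by simpa using k12, henum₄⟩
        simpa [show j ≠ 10 by omega] using hreg₄ j hj
  · rintro s' ⟨e10, hreg, -⟩
    simp [e10, hreg 5 (by omega), h5]

/-- The test that the search applies to the modulus `r`. -/
def Admissible (A d k r : ℕ) : Prop :=
  Nat.count (NegRoot A d r) r = k ∧ Nat.count (· ∣ r) r = 1

theorem findPrime_ensures (hA : 2 ≤ A) (hhi : d < A ^ (k + 1)) (hkB : k + 1 ≤ B)
    (hs : HasDigits A d k s) (hqB : q ≤ B) (hq2 : 2 ≤ q) (hq : Admissible A d k q)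
    (hmin : ∀ r, 2 ≤ r → r < q → ¬ Admissible A d k r) :
    findPrime.Ensures B s (q * (q * (3 * k + 14) + 8) + 3) fun s' => RegEq 5 s s' ∧
      (∀ a ≠ 0, s'.arr a = s.arr a) ∧ s'.reg 5 = q ∧
      ∀ x < q, NegRoot A d q x → s'.arr 0 (Nat.count (NegRoot A d q) x) = x := by
  unfold findPrime
  refine .mono (n₁ := ((q - 1) * ((q * (3 * k + 14) + 7) + 1) + 1) + 1 + 1)
    (R := fun s' => s'.reg 5 = 1 + (q - 1) ∧ s'.reg 6 = (if q - 1 = q - 1 then 1 else 0) ∧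
      RegEq 5 s s' ∧ (∀ a ≠ 0, s'.arr a = s.arr a) ∧ (q - 1 = q - 1 →
      ∀ x < q, NegRoot A d q x → s'.arr 0 (Nat.count (NegRoot A d q) x) = x)) ?_ ?_
    fun s' h => ⟨h.2.2.1, h.2.2.2.1, by rw [h.1]; omega, h.2.2.2.2 rfl⟩
  swap
  · have : (q - 1) * ((q * (3 * k + 14) + 7) + 1) ≤ q * (q * (3 * k + 14) + 8) :=
      Nat.mul_le_mul (by omega) le_rfl
    omega
  refine .assign_seq (by simp; omega) (.assign_seq (by simp) ?_)
  refine .loop (fun i s' => s'.reg 5 = 1 + i ∧ s'.reg 6 = (if i = q - 1 then 1 else 0) ∧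
      RegEq 5 s s' ∧ (∀ a ≠ 0, s'.arr a = s.arr a) ∧ (i = q - 1 →
      ∀ x < q, NegRoot A d q x → s'.arr 0 (Nat.count (NegRoot A d q) x) = x)) (q - 1) ?_ ?_ ?_
  · refine ⟨by simp, ?_, fun j hj => ?_, by simp, fun h => by omega⟩
    · simp; omega
    · simp [show j ≠ 5 by omega, show j ≠ 6 by omega]
  · rintro i s₁ hi ⟨e5, e6, hreg, harr, -⟩
    refine ⟨by simp [e6, hi.ne], ?_⟩
    refine .mono (n₁ := (q * (3 * k + 14) + 5 + 1) + 1) ?_ (by omega) fun _ h => h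
    refine .assign_seq (by simp [e5]; omega) ?_
    refine .seq (n₁ := q * (3 * k + 14) + 5) (n₂ := 1) (.mono (scan_ensures (r := i + 2) hA hhi hkB
      (hs.congr ?_ ?_) (by omega) (by omega) ?_) (by gcongr; omega) fun _ h => h) ?_
    · simpa using hreg 3 (by omega)
    · simpa using harr 3 (by omega)
    · simp [e5]; omega
    rintro s₂ ⟨hreg₂, harr₂, e11, e12, henum⟩
    have e3 : s₂.reg 3 = k := by
      rw [hreg₂ 3 (by omega)]; simpa [hreg 3 (by omega)] using hs.reg
    -- The divisor 1 is always counted, so the truncated difference with 1 vanishes only if the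
    -- count equals 1.
    have hone : 1 ≤ Nat.count (· ∣ i + 2) (i + 2) := by
      have h1 : Nat.count (· ∣ i + 2) 2 = 1 := by
        simp [Nat.count_succ]
      rw [← h1]
      exact Nat.count_monotone _ (by omega)
    have hadm : Admissible A d k (i + 2) ↔ i + 1 = q - 1 := by
      constructor
      · intro h
        by_contra hne
        exact hmin (i + 2) (by omega) (by omega) h
      · intro h
        rwa [show i + 2 = q by omega]
    refine .assign ?_ ⟨?_, ?_, fun j hj => ?_, fun a ha => ?_, fun h => ?_⟩
    · exact (Nat.sub_le _ _).trans (by simp; omega)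
    · simp [hreg₂ 5 (by omega), e5]; omega
    · simp only [MachineState.setReg_reg, MachineExpr.eval, reduceIte, e11, e12, e3]
      split_ifs with h
      · obtain ⟨h1, h2⟩ := hadm.2 h
        rw [h1, h2]; simp
      · have h' : ¬ Admissible A d k (i + 2) := fun h1 => h (hadm.1 h1)
        unfold Admissible at h'
        omega
    · simp only [MachineState.setReg_reg, show j ≠ 6 by omega, if_false]
      rw [hreg₂ j (by omega), ← hreg j hj]
      simp [show j ≠ 5 by omega]
    · simp only [MachineState.setReg_arr, harr₂ a ha]
      exact harr a ha
    · rw [show i + 2 = q by omega] at henum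
      exact henum
  · rintro s' ⟨-, e6, -⟩
    simp [e6]

/-- Each multiplication starts from a power of `q` below `d`, so the modulus never exceeds `d * q`.
-/
theorem precision_ensures (hq : 2 ≤ q) (hd : 2 ≤ d) (hB : d * q ≤ B) (h0 : s.reg 0 = d)
    (h5 : s.reg 5 = q) :
    precision.Ensures B s (3 * Nat.clog q d + 3) fun s' => s'.arr = s.arr ∧
      s'.reg 3 = s.reg 3 ∧ s'.reg 5 = q ∧ s'.reg 2 = Nat.clog q d ∧
      s'.reg 7 = q ^ Nat.clog q d := by
  have hpow : ∀ i < Nat.clog q d, q ^ i < d := fun i hi => Nat.pow_lt_of_lt_clog hi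
  have hclog : Nat.clog q d ≤ B := by
    have h1 : Nat.clog q d - 1 < d :=
      (Nat.lt_pow_self (by omega)).trans (Nat.pow_pred_clog_lt_self hq hd)
    have : d ≤ d * q := Nat.le_mul_of_pos_right _ (by omega)
    omega
  unfold precision
  refine .mono (n₁ := (Nat.clog q d * (2 + 1) + 1) + 1 + 1)
    (R := fun s' => s'.arr = s.arr ∧ (∀ j < 7, j ≠ 2 → s'.reg j = s.reg j) ∧
      s'.reg 2 = Nat.clog q d ∧ s'.reg 7 = q ^ Nat.clog q d) ?_ (by omega)
    fun s' h => ⟨h.1, h.2.1 3 (by omega) (by omega), by rw [h.2.1 5 (by omega) (by omega), h5],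
      h.2.2⟩
  refine .assign_seq (by simp) (.assign_seq (by simp; nlinarith) ?_)
  refine .loop (fun i s' => s'.arr = s.arr ∧ (∀ j < 7, j ≠ 2 → s'.reg j = s.reg j) ∧
      s'.reg 2 = i ∧ s'.reg 7 = q ^ i) (Nat.clog q d) ?_ ?_ ?_
  · exact ⟨rfl, fun j hj hj' => by simp [hj', hj.ne], by simp, by simp⟩
  · rintro i s' hi ⟨ha, hr, e2, e7⟩
    have e5 : s'.reg 5 = q := by rw [hr 5 (by omega) (by omega), h5]
    have e0 : s'.reg 0 = d := by rw [hr 0 (by omega) (by omega), h0]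
    have hlt := hpow i hi
    refine ⟨by simp [e0, e7]; omega, ?_⟩
    refine .assign_seq (n := 1) ?_ (.assign ?_ ⟨ha, fun j hj hj' => ?_, ?_, ?_⟩)
    · simp only [MachineExpr.eval, e7, e5]
      exact (Nat.mul_le_mul hlt.le le_rfl).trans hB
    · simp [e2]; omega
    · simpa [hj', hj.ne] using hr j hj hj'
    · simp [e2]
    · simp [e7, e5, pow_succ]
  · rintro s' ⟨-, hr, -, e7⟩
    simp only [MachineExpr.eval, e7, hr 0 (by omega) (by omega), h0]
    exact Nat.sub_eq_zero_of_le (Nat.le_pow_clog hq d)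

/-- `T` is the unknown target. The test only has to recognize `T` modulo `q ^ (j + 1)` among the
numbers that agree with it modulo `q ^ j`. This serves both for roots (`j₀ = 1`) and for inverses
(`j₀ = 0`). -/
theorem lift_ensures {test : MachineProg} {n j₀ T : ℕ} (hq : 2 ≤ q) (hB : q ^ m ≤ B) (hj₀ : j₀ ≤ m)
    (h5 : s.reg 5 = q) (h7 : s.reg 7 = q ^ m) (h16 : s.reg 16 = q ^ j₀)
    (h21 : s.reg 21 = T % q ^ j₀)
    (htest : ∀ (s' : MachineState) (j x : ℕ), RegEq 16 s s' → s'.arr = s.arr → j₀ ≤ j → j < m →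
      s'.reg 20 = q ^ (j + 1) → s'.reg 21 = x → x < q ^ (j + 1) → x % q ^ j = T % q ^ j →
      test.Ensures B s' n fun s'' => RegEq 22 s' s'' ∧ s''.arr = s'.arr ∧
        (s''.reg 23 = 0 ↔ x = T % q ^ (j + 1))) :
    (lift test).Ensures B s (m * (n + q * (n + 2) + 4) + 1) fun s' => RegEq 16 s s' ∧
      s'.arr = s.arr ∧ s'.reg 21 = T % q ^ m := by
  unfold lift
  refine .mono (n₁ := (m - j₀) * ((n + q * (n + 2) + 3) + 1) + 1)
    (R := fun s' => RegEq 16 s s' ∧ s'.arr = s.arr ∧ s'.reg 16 = q ^ (j₀ + (m - j₀)) ∧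
      s'.reg 21 = T % q ^ (j₀ + (m - j₀))) ?_
    (Nat.succ_le_succ (Nat.mul_le_mul (Nat.sub_le _ _) le_rfl))
    fun s' h => ⟨h.1, h.2.1, by simpa [hj₀] using h.2.2.2⟩
  refine .loop (fun i s' => RegEq 16 s s' ∧ s'.arr = s.arr ∧ s'.reg 16 = q ^ (j₀ + i) ∧
      s'.reg 21 = T % q ^ (j₀ + i)) (m - j₀) ?_ ?_ ?_
  · exact ⟨fun _ _ => rfl, rfl, by simpa using h16, by simpa using h21⟩
  · rintro i s₁ hi ⟨hreg, harr, e16, e21⟩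
    set j := j₀ + i with hj
    have e5 : s₁.reg 5 = q := by rw [hreg 5 (by omega), h5]
    have e7 : s₁.reg 7 = q ^ m := by rw [hreg 7 (by omega), h7]
    have hpos : 0 < q ^ j := by positivity
    have hstep : q ^ (j + 1) ≤ B := (Nat.pow_le_pow_right (by omega) (by omega)).trans hB
    have hsucc : q ^ (j + 1) = q ^ j * q := pow_succ _ _
    have hlt : q ^ j < q ^ m := Nat.pow_lt_pow_right (by omega) (by omega)
    have hmod : T % q ^ (j + 1) = T % q ^ j + q ^ j * (T / q ^ j % q) := by
      rw [hsucc, Nat.mod_mul]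
    -- The next base-`q` digit of `T`, which is the number of increments until the test succeeds.
    set t := T / q ^ j % q with ht
    have htq : t < q := Nat.mod_lt _ (by omega)
    have hxlt : ∀ u ≤ t, T % q ^ j + u * q ^ j < q ^ (j + 1) := by
      intro u hu
      have h1 := Nat.mod_lt T hpos
      have h2 : (u + 1) * q ^ j ≤ q * q ^ j := Nat.mul_le_mul (by omega) le_rfl
      rw [add_mul] at h2
      rw [hsucc, mul_comm (q ^ j)]
      omega
    have hxeq : ∀ u, T % q ^ j + u * q ^ j = T % q ^ (j + 1) ↔ u = t := by
      intro u
      rw [hmod, mul_comm, Nat.add_left_cancel_iff]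
      exact Nat.mul_right_inj hpos.ne'
    have hxmod : ∀ u, (T % q ^ j + u * q ^ j) % q ^ j = T % q ^ j := by
      intro u
      simp
    refine ⟨by simp [e7, e16]; omega, ?_⟩
    refine .mono (n₁ := (n + ((t * ((n + 1) + 1) + 1) + 1)) + 1) ?_ ?_ fun _ h => h
    swap
    · have : t * ((n + 1) + 1) ≤ q * (n + 2) := Nat.mul_le_mul htq.le le_rfl
      omega
    refine .assign_seq (by simp only [MachineExpr.eval, e16, e5, ← hsucc]; exact hstep) ?_
    refine .seq (n₁ := n) (n₂ := (t * ((n + 1) + 1) + 1) + 1)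
      (htest _ j (T % q ^ j) (fun l hl => ?_) ?_ (by omega) (by omega) ?_ ?_ ?_ ?_) ?_
    · simpa [show l ≠ 20 by omega] using hreg l hl
    · simpa using harr
    · simp [e16, e5, hsucc]
    · simpa using e21
    · simpa using hxlt 0 (by omega)
    · simp
    rintro s₂ ⟨hreg₂, harr₂, e23⟩
    refine .seq (n₁ := t * ((n + 1) + 1) + 1) (n₂ := 1)
      (.loop (fun u s' => RegEq 16 s s' ∧ s'.arr = s.arr ∧ s'.reg 16 = q ^ j ∧
      s'.reg 20 = q ^ (j + 1) ∧ s'.reg 21 = T % q ^ j + u * q ^ j ∧ (s'.reg 23 = 0 ↔ u = t)) t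
      ?_ ?_ ?_) ?_
    · refine ⟨fun l hl => ?_, ?_, ?_, ?_, ?_, ?_⟩
      · rw [hreg₂ l (by omega), ← hreg l hl]
        simp [show l ≠ 20 by omega]
      · rw [harr₂]; simpa using harr
      · rw [hreg₂ 16 (by omega)]; simpa using e16
      · rw [hreg₂ 20 (by omega)]; simp [e16, e5, hsucc]
      · rw [hreg₂ 21 (by omega)]; simpa using e21
      · rw [e23, ← hxeq 0]; simp
    · rintro u s₃ hu ⟨hreg₃, harr₃, f16, f20, f21, f23⟩
      have hx : T % q ^ j + u * q ^ j + q ^ j = T % q ^ j + (u + 1) * q ^ j := by ring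
      refine ⟨by simp [f23, hu.ne], ?_⟩
      refine .assign_seq ?_ ?_
      · simp only [MachineExpr.eval, f16, f21, hx]
        exact (hxlt _ hu).le.trans hstep
      · refine .mono (htest _ j (T % q ^ j + (u + 1) * q ^ j) (fun l hl => ?_) harr₃ (by omega)
          (by omega) ?_ ?_ (hxlt _ hu) (hxmod _)) le_rfl ?_
        · simpa [show l ≠ 21 by omega] using hreg₃ l hl
        · simpa using f20
        · simp [f16, f21, hx]
        · rintro s₄ ⟨hreg₄, harr₄, g23⟩
          refine ⟨fun l hl => ?_, ?_, ?_, ?_, ?_, ?_⟩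
          · rw [hreg₄ l (by omega), ← hreg₃ l hl]
            simp [show l ≠ 21 by omega]
          · rw [harr₄]; exact harr₃
          · rw [hreg₄ 16 (by omega)]; simpa using f16
          · rw [hreg₄ 20 (by omega)]; simpa using f20
          · rw [hreg₄ 21 (by omega)]; simp [f16, f21, hx]
          · rw [g23, hxeq]
    · rintro s₃ ⟨-, -, -, -, -, f23⟩
      simpa using f23
    · rintro s₃ ⟨hreg₃, harr₃, f16, f20, f21, -⟩
      refine .assign (by simpa [f20] using hstep) ⟨fun l hl => ?_, harr₃, ?_, ?_⟩
      · simpa [show l ≠ 16 by omega] using hreg₃ l hl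
      · simpa [← add_assoc, ← hj] using f20
      · simp only [MachineState.setReg_reg, Nat.reduceEqDiff, if_false, f21]
        exact (hxeq t).2 rfl
  · rintro s' ⟨hreg, -, e16, -⟩
    simp [e16, hreg 7 (by omega), h7, hj₀]

/-- Adding `M - 1` subtracts 1 modulo `M` without risking truncation. -/
theorem inverseTest_ensures {M x c : ℕ} (hM : 0 < M) (hMB : M ≤ B) (h20 : s.reg 20 = M)
    (h21 : s.reg 21 = x) (h15 : s.reg 15 = c) :
    inverseTest.Ensures B s 1 fun s' => RegEq 22 s s' ∧ s'.arr = s.arr ∧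
      s'.reg 23 = (x * c + (M - 1)) % M := by
  refine .assign ?_ ⟨fun j hj => ?_, rfl, ?_⟩
  · simpa [h20] using (Nat.mod_lt _ hM).le.trans hMB
  · simp [show j ≠ 23 by omega]
  · simp [h20, h21, h15]

/-- The inputs of the lifting phase together with the values that it has to find. -/
structure LiftData (A d k q m : ℕ) (β c b : ℕ → ℕ) : Prop where
  lift_lt : ∀ i < k, c i < q ^ m
  lift_mod : ∀ i < k, c i % q = β i
  inverse_lt : ∀ i < k, b i < q ^ m
  -- For `j = 0` the congruence would be empty and all `k` roots modulo `q` would pass, so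
  -- uniqueness starts at `j = 1`.
  root_iff : ∀ i < k, ∀ j < m, 1 ≤ j → ∀ x < q ^ (j + 1), x % q ^ j = c i % q ^ j →
    (NegRoot A d (q ^ (j + 1)) x ↔ x = c i % q ^ (j + 1))
  inverse_iff : ∀ i < k, ∀ j < m, ∀ x < q ^ (j + 1),
    ((x * c i + (q ^ (j + 1) - 1)) % q ^ (j + 1) = 0 ↔ x = b i % q ^ (j + 1))

theorem liftAll_ensures {β c b : ℕ → ℕ} (hA : 2 ≤ A) (hhi : d < A ^ (k + 1)) (hkB : k + 1 ≤ B)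
    (hs : HasDigits A d k s) (hq : 2 ≤ q) (hm : 1 ≤ m) (hB : q ^ m ≤ B)
    (h5 : s.reg 5 = q) (h7 : s.reg 7 = q ^ m) (hβ : ∀ i < k, s.arr 0 i = β i)
    (hL : LiftData A d k q m β c b) :
    liftAll.Ensures B s (k * (m * ((3 * k + 6) + q * (3 * k + 8) + 4) + m * (q * 3 + 5) + 11) + 2)
      fun s' => RegEq 8 s s' ∧ (∀ i < k, s'.arr 0 i = β i) ∧ (∀ i < k, s'.arr 1 i = c i) ∧
        ∀ i < k, s'.arr 2 i = b i := by
  have hqB : q ≤ B := by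
    refine le_trans ?_ hB
    simpa using Nat.pow_le_pow_right (show 0 < q by omega) hm
  unfold liftAll
  set N := m * ((3 * k + 6) + q * ((3 * k + 6) + 2) + 4) + 1 with hN
  set N' := m * (1 + q * (1 + 2) + 4) + 1 with hN'
  refine .mono (n₁ := (k * (((N + (((((N' + (1 + 1)) + 1) + 1) + 1) + 1)) + 1 + 1) + 1) + 1) + 1)
    (R := fun s' => s'.reg 8 = k ∧ RegEq 8 s s' ∧ (∀ a ≠ 1, a ≠ 2 → s'.arr a = s.arr a) ∧
      (∀ i < k, s'.arr 1 i = c i) ∧ ∀ i < k, s'.arr 2 i = b i) ?_ ?_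
    fun s' h => ⟨h.2.1, fun i hi => by rw [h.2.2.1 0 (by omega) (by omega), hβ i hi], h.2.2.2⟩
  swap
  · refine Nat.succ_le_succ (Nat.succ_le_succ (Nat.mul_le_mul le_rfl (le_of_eq ?_)))
    rw [hN, hN']
    ring
  refine .assign_seq (by simp) ?_
  refine .loop (fun i s' => s'.reg 8 = i ∧ RegEq 8 s s' ∧
      (∀ a ≠ 1, a ≠ 2 → s'.arr a = s.arr a) ∧
      (∀ l < i, s'.arr 1 l = c l) ∧ ∀ l < i, s'.arr 2 l = b l) k ?_ ?_ ?_
  · exact ⟨by simp, fun j hj => by simp [hj.ne], fun _ _ _ => rfl, by simp, by simp⟩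
  · rintro i s₁ hi ⟨e8, hreg, harr, hc, hb⟩
    have e3 : s₁.reg 3 = k := by rw [hreg 3 (by omega), hs.reg]
    have e5 : s₁.reg 5 = q := by rw [hreg 5 (by omega), h5]
    have e7 : s₁.reg 7 = q ^ m := by rw [hreg 7 (by omega), h7]
    have ea : s₁.arr 0 i = β i := by rw [harr 0 (by omega) (by omega), hβ i hi]
    have hβq : β i < q := by
      rw [← hL.lift_mod i hi]; exact Nat.mod_lt _ (by omega)
    refine ⟨by simp [e3, e8]; omega, ?_⟩
    refine .assign_seq (by simp [e8, ea]; omega) (.assign_seq (by simp [e5]; omega) ?_)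
    refine .seq (n₁ := N) (n₂ := ((((N' + (1 + 1)) + 1) + 1) + 1) + 1)
      (lift_ensures (j₀ := 1) (T := c i) (m := m) (n := 3 * k + 6) hq hB hm ?_ ?_ ?_ ?_ ?_) ?_
    · simpa using e5
    · simpa using e7
    · simp [e5]
    · simp [e8, ea, hL.lift_mod i hi]
    · intro s' j x hr ha hj₀ hj h20 h21 hx hxm
      refine .mono (horner_ensures hA hhi hkB (hs.congr ?_ ?_) (M := q ^ (j + 1)) (x := x)
        (by positivity) ((Nat.pow_le_pow_right (by omega) (by omega)).trans hB) h20 h21) le_rfl ?_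
      · rw [hr 3 (by omega), ← hreg 3 (by omega)]; simp
      · rw [ha, ← harr 3 (by omega) (by omega)]; simp
      · rintro s'' ⟨h1, h2, h3⟩
        refine ⟨h1, h2, ?_⟩
        rw [h3, ← hL.root_iff i hi j hj hj₀ x hx hxm, NegRoot, Nat.dvd_iff_mod_eq_zero]
    rintro s₂ ⟨hreg₂, harr₂, f21⟩
    rw [Nat.mod_eq_of_lt (hL.lift_lt i hi)] at f21
    have hreg₂' : ∀ l < 15, s₂.reg l = s₁.reg l := fun l hl => by
      rw [hreg₂ l (by omega)]; simp [show l ≠ 16 by omega, show l ≠ 21 by omega]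
    have f8 : s₂.reg 8 = i := by rw [hreg₂' 8 (by omega), e8]
    have hcB : c i ≤ B := (hL.lift_lt i hi).le.trans hB
    refine .put_seq (by simpa [f21] using hcB) (.assign_seq (by simpa [f21] using hcB)
      (.assign_seq (by simp) (.assign_seq (by simp; omega) ?_)))
    -- Inverses are unique already modulo `q`, so this lift starts from 0 modulo `q ^ 0 = 1`.
    refine .seq (n₁ := N') (n₂ := 1 + 1)
      (lift_ensures (j₀ := 0) (T := b i) (m := m) (n := 1) hq hB (by omega) ?_ ?_ ?_ ?_ ?_) ?_
    · simp [hreg₂', e5]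
    · simp [hreg₂', e7]
    · simp
    · simp [Nat.mod_one]
    · intro s' j x hr ha hj₀ hj h20 h21 hx hxm
      refine .mono (inverseTest_ensures (M := q ^ (j + 1)) (x := x) (c := c i)
        (by positivity) ((Nat.pow_le_pow_right (by omega) (by omega)).trans hB) h20 h21 ?_)
        le_rfl ?_
      · rw [hr 15 (by omega)]; simp [f21]
      · rintro s'' ⟨h1, h2, h3⟩
        exact ⟨h1, h2, by rw [h3, hL.inverse_iff i hi j hj x hx]⟩
    rintro s₃ ⟨hreg₃, harr₃, g21⟩
    rw [Nat.mod_eq_of_lt (hL.inverse_lt i hi)] at g21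
    have hreg₃' : ∀ l < 15, s₃.reg l = s₁.reg l := fun l hl => by
      rw [hreg₃ l (by omega), ← hreg₂' l hl]
      simp [show l ≠ 15 by omega, show l ≠ 16 by omega, show l ≠ 21 by omega]
    have g8 : s₃.reg 8 = i := by rw [hreg₃' 8 (by omega), e8]
    refine .put_seq (n := 1) ?_ (.assign ?_ ⟨?_, fun l hl => ?_, fun a h1 h2 => ?_, fun l hl => ?_,
      fun l hl => ?_⟩)
    · simpa [g21] using (hL.inverse_lt i hi).le.trans hB
    · simp [g8]; omega
    · simp [g8]
    · simpa [hl.ne, hreg₃' l (by omega)] using hreg l hl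
    · funext l
      simp [h1, h2, harr₃, harr₂, harr a h1 h2]
    · simp only [MachineState.setReg_arr, MachineState.setArr_arr, harr₃, harr₂]
      rcases Nat.lt_succ_iff_lt_or_eq.1 hl with h | rfl
      · simpa [f8, h.ne] using hc l h
      · simp [f8, f21]
    · simp only [MachineState.setReg_arr, MachineState.setArr_arr, harr₃, harr₂]
      rcases Nat.lt_succ_iff_lt_or_eq.1 hl with h | rfl
      · simpa [g8, h.ne] using hb l h
      · simp [g8, g21]
  · rintro s' ⟨e8, hreg, -⟩
    simp [e8, hreg 3 (by omega), hs.reg]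

/-- The number of steps of `main`. -/
def steps (k q m : ℕ) : ℕ :=
  (4 * k + 8) + ((q * (q * (3 * k + 14) + 8) + 3) + ((3 * m + 3) +
    ((k * (m * ((3 * k + 6) + q * (3 * k + 8) + 4) + m * (q * 3 + 5) + 11) + 2) + (1 + 1))))

theorem exists_count_eq {p : ℕ → Prop} [DecidablePred p] {n i : ℕ} (hi : i < Nat.count p n) :
    ∃ x < n, p x ∧ Nat.count p x = i := by
  induction n with
  | zero => simp at hi
  | succ n ih =>
    by_cases h : i < Nat.count p n
    · obtain ⟨x, hx, h'⟩ := ih h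
      exact ⟨x, by omega, h'⟩
    · rw [Nat.count_succ] at hi
      by_cases hp : p n
      · rw [if_pos hp] at hi
        exact ⟨n, by omega, hp, by omega⟩
      · rw [if_neg hp] at hi
        omega

theorem main_ensures {c b : ℕ → ℕ} (hA : 2 ≤ A) (hk : 1 ≤ k) (hlo : A ^ k ≤ d)
    (hhi : d < A ^ (k + 1)) (hq2 : 2 ≤ q) (hq : Admissible A d k q)
    (hmin : ∀ r, 2 ≤ r → r < q → ¬ Admissible A d k r)
    (hL : LiftData A d k q (Nat.clog q d) (Nat.nth (NegRoot A d q)) c b) :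
    main.Ensures (d * q) (inputState d A) (steps k q (Nat.clog q d)) fun s =>
      s.reg 0 = k ∧ s.reg 1 = q ∧ s.reg 2 = Nat.clog q d ∧
      (∀ i < k, s.arr 0 i = Nat.nth (NegRoot A d q) i) ∧ (∀ i < k, s.arr 1 i = c i) ∧
      ∀ i < k, s.arr 2 i = b i := by
  have hkd : k < d := (Nat.lt_pow_self (by omega)).trans_le hlo
  have hdB : d ≤ d * q := Nat.le_mul_of_pos_right _ (by omega)
  have hqB : q ≤ d * q := Nat.le_mul_of_pos_left _ (by omega)
  have hm : 1 ≤ Nat.clog q d := Nat.clog_pos (by omega) (by omega)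
  -- The last power of `q` below `d`, times `q`; so `d * q` bounds every stored value.
  have hQB : q ^ Nat.clog q d ≤ d * q := by
    obtain ⟨n, hn⟩ := Nat.exists_eq_add_of_le' hm
    have h1 : q ^ n < d := Nat.pow_lt_of_lt_clog (by omega)
    rw [hn, pow_succ]
    exact Nat.mul_le_mul h1.le le_rfl
  unfold main steps
  refine .seq (digits_ensures hA hlo hhi hdB (by omega) (by simp [inputState])
    (by simp [inputState])) ?_
  rintro s₁ ⟨hs₁, hreg₁⟩
  refine .seq (findPrime_ensures hA hhi (by omega) hs₁ hqB hq2 hq hmin) ?_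
  rintro s₂ ⟨hreg₂, harr₂, f5, henum⟩
  refine .seq (precision_ensures hq2 (by omega) le_rfl ?_ f5) ?_
  · rw [hreg₂ 0 (by omega), hreg₁ 0 (by omega)]; simp [inputState]
  rintro s₃ ⟨harr₃, g3, g5, g2, g7⟩
  refine .seq (liftAll_ensures (β := Nat.nth (NegRoot A d q)) hA hhi (by omega)
    (hs₁.congr ?_ ?_) hq2 hm hQB g5 g7 ?_ hL) ?_
  · rw [g3, hreg₂ 3 (by omega)]
  · rw [harr₃, harr₂ 3 (by omega)]
  · intro i hi
    have hi' : i < Nat.count (NegRoot A d q) q := by rw [hq.1]; exact hi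
    rw [harr₃]
    obtain ⟨x, hx, hp, rfl⟩ := exists_count_eq hi'
    rw [Nat.nth_count hp, henum x hx hp]
  rintro s₄ ⟨hreg₄, h0, h1, h2⟩
  have e3 : s₄.reg 3 = k := by
    rw [hreg₄ 3 (by omega), g3, hreg₂ 3 (by omega), hs₁.reg]
  have e5 : s₄.reg 5 = q := by rw [hreg₄ 5 (by omega), g5]
  refine .assign_seq (n := 1) (by simp [e3]; omega) (.assign (by simpa [e5] using hqB)
    ⟨by simp [e3], by simp [e5], ?_, h0, h1, h2⟩)
  simp [hreg₄ 2 (by omega), g2]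

end BHProg

/-! ### Numbers that are products of `b i * A + 1` -/

section Digits

variable {k A d : ℕ} {b : Fin k → ℕ}

theorem coeff_prod_C_mul_X_add_one {ι : Type*} (s : Finset ι) (f : ι → ℕ) (j : ℕ) :
    (∏ i ∈ s, (C (f i) * X + 1 : ℕ[X])).coeff j = ∑ t ∈ s.powersetCard j, ∏ i ∈ t, f i := by
  classical
  rw [Finset.prod_add_one, finsetSum_coeff, Finset.powersetCard_eq_filter, Finset.sum_filter]
  refine Finset.sum_congr rfl fun t _ => ?_
  rw [Finset.prod_mul_distrib, Finset.prod_const, ← map_prod, coeff_C_mul, coeff_X_pow]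
  by_cases h : j = t.card
  · simp [h]
  · simp [h, Ne.symm h]

/-- Every partial product is at most the full one since `b i ≥ 1`, there are `k.choose j` of them,
and the middle binomial coefficient is the largest. -/
theorem coeff_prod_le (hb : ∀ i, 1 ≤ b i) (j : ℕ) :
    (∏ i, (C (b i) * X + 1 : ℕ[X])).coeff j ≤ k.choose (k / 2) * ∏ i, b i := by
  rw [coeff_prod_C_mul_X_add_one]
  calc _ ≤ ∑ t ∈ (Finset.univ : Finset (Fin k)).powersetCard j, ∏ i, b i :=
        Finset.sum_le_sum fun t _ =>
          Finset.prod_le_prod_of_subset_of_one_le' (Finset.subset_univ t) fun i _ _ => hb i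
    _ = k.choose j * ∏ i, b i := by simp
    _ ≤ _ := Nat.mul_le_mul (Nat.choose_le_middle j k) le_rfl

theorem ofDigits_ofFn {R : Type*} [CommSemiring R] (x : R) (n : ℕ) (f : Fin n → ℕ) :
    Nat.ofDigits x (List.ofFn f) = ∑ i, (f i : R) * x ^ (i : ℕ) := by
  induction n with
  | zero => simp [Nat.ofDigits]
  | succ n ih =>
    rw [List.ofFn_succ, Nat.ofDigits, ih, Fin.sum_univ_succ, Finset.mul_sum]
    simp only [Fin.val_zero, pow_zero, mul_one, Fin.val_succ, pow_succ]
    congr 1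
    exact Finset.sum_congr rfl fun i _ => by ring

theorem natDegree_prod_lt : (∏ i, (C (b i) * X + 1 : ℕ[X])).natDegree < k + 1 := by
  refine Nat.lt_succ_of_le ((natDegree_prod_le _ _).trans ?_)
  calc _ ≤ ∑ i : Fin k, 1 := Finset.sum_le_sum fun i _ => by
        rw [← C_1]; exact natDegree_linear_le
    _ = k := by simp

/-- No carries occur: the coefficients are below `A` and the top one, `∏ b i`, is nonzero, so
uniqueness of the base-`A` expansion applies. -/
theorem digits_prod (hb : ∀ i, 1 ≤ b i) (hA : 2 ≤ A) (hd : d = ∏ i, (b i * A + 1))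
    (h : k.choose (k / 2) * ∏ i, b i < A) :
    Nat.digits A d =
      List.ofFn fun i : Fin (k + 1) => (∏ i, (C (b i) * X + 1 : ℕ[X])).coeff i := by
  have hd' : d = Nat.ofDigits A
      (List.ofFn fun i : Fin (k + 1) => (∏ i, (C (b i) * X + 1 : ℕ[X])).coeff i) := by
    have h1 : (∏ i, (C (b i) * X + 1 : ℕ[X])).eval A = d := by
      rw [hd, eval_prod]; simp
    rw [ofDigits_ofFn, ← h1, eval_eq_sum_range' natDegree_prod_lt, Finset.sum_range]
    simp
  rw [hd']
  refine Nat.digits_ofDigits A (by omega) _ ?_ fun hne => ?_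
  · intro l hl
    obtain ⟨i, rfl⟩ := (List.mem_ofFn' _ _).1 hl
    exact (coeff_prod_le hb _).trans_lt h
  · rw [List.getLast_ofFn]
    simp only [coeff_prod_C_mul_X_add_one]
    have : (Finset.univ : Finset (Fin k)).powersetCard k = {Finset.univ} := by
      simpa using Finset.powersetCard_self (Finset.univ : Finset (Fin k))
    simp only [add_tsub_cancel_right, this, Finset.sum_singleton]
    exact (Finset.prod_pos fun i _ => hb i).ne'

/-- A general semiring covers two uses: `ℤ[X]` gives the factorization of `g`, and `ℕ` gives the
values computed by Horner evaluation. -/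
theorem ofDigits_digits_prod {R : Type*} [CommSemiring R] (hb : ∀ i, 1 ≤ b i) (hA : 2 ≤ A)
    (hd : d = ∏ i, (b i * A + 1)) (h : k.choose (k / 2) * ∏ i, b i < A) (x : R) :
    Nat.ofDigits x (Nat.digits A d) = ∏ i, ((b i : R) * x + 1) := by
  have h1 : (∏ i, (C (b i) * X + 1 : ℕ[X])).eval₂ (Nat.castRingHom R) x =
      ∏ i, ((b i : R) * x + 1) := by
    rw [eval₂_finsetProd]
    simp
  rw [digits_prod hb hA hd h, ofDigits_ofFn, ← h1,
    eval₂_eq_sum_range' _ natDegree_prod_lt, Finset.sum_range]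
  simp

theorem digitPoly_eq_prod (hb : ∀ i, 1 ≤ b i) (hA : 2 ≤ A) (hd : d = ∏ i, (b i * A + 1))
    (h : k.choose (k / 2) * ∏ i, b i < A) :
    digitPoly A d = ∏ i, (C (b i : ℤ) * X + 1) := by
  rw [digitPoly, ofDigits_digits_prod hb hA hd h]
  simp

theorem exists_digits_eq (hb : ∀ i, 1 ≤ b i) (hA : 2 ≤ A) (hd : d = ∏ i, (b i * A + 1))
    (h : k.choose (k / 2) * ∏ i, b i < A) :
    ∃ a : Fin k → ℕ, Nat.digits A d = 1 :: List.ofFn a ∧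
      digitPoly A d = 1 + ∑ i : Fin k, C (a i : ℤ) * X ^ (i.val + 1) := by
  have h0 : (∏ i, (C (b i) * X + 1 : ℕ[X])).coeff 0 = 1 := by
    rw [coeff_prod_C_mul_X_add_one]; simp
  refine ⟨fun i => (∏ i, (C (b i) * X + 1 : ℕ[X])).coeff (i + 1), ?_, ?_⟩
  · rw [digits_prod hb hA hd h, List.ofFn_succ, Fin.val_zero, h0]
    rfl
  · rw [digitPoly, digits_prod hb hA hd h, ofDigits_ofFn, Fin.sum_univ_succ, Fin.val_zero, h0]
    simp

/-- The elementary part of the hypotheses of the main theorem. -/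
theorem exponents_eq_one {p e : Fin k → ℕ} (hp : ∀ i, (p i).Prime) (he : ∀ i, 1 ≤ e i)
    (hd : d = ∏ i, p i ^ e i) (hpb : ∀ i, p i = b i * A + 1)
    (h : k.choose (k / 2) * d < A ^ (k + 1)) :
    2 ≤ A ∧ (∀ i, 1 ≤ b i) ∧ (∀ i, e i = 1) ∧ d = ∏ i, (b i * A + 1) ∧
      k.choose (k / 2) * ∏ i, b i < A := by
  have hch : 1 ≤ k.choose (k / 2) := Nat.choose_pos (Nat.div_le_self _ _)
  have hdpos : 1 ≤ d := by
    rw [hd]; exact Finset.prod_pos fun i _ => pow_pos (hp i).pos _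
  have hA : 2 ≤ A := by
    by_contra hA
    have : A ^ (k + 1) ≤ 1 := Nat.pow_le_one_iff (by omega) |>.2 (by omega)
    nlinarith
  have hb : ∀ i, 1 ≤ b i := fun i => by
    by_contra hbi
    have h0 : b i = 0 := by omega
    have := (hp i).two_le
    rw [hpb, h0] at this
    omega
  have hAp : ∀ i, A ≤ p i := fun i => by rw [hpb]; nlinarith [hb i]
  have hle : A ^ ∑ i, e i ≤ d := by
    rw [hd, ← Finset.prod_pow_eq_pow_sum]
    exact Finset.prod_le_prod' fun i _ => Nat.pow_le_pow_left (hAp i) _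
  have hsum : ∑ i, e i < k + 1 := by
    refine (Nat.pow_lt_pow_iff_right (show 1 < A by omega)).1 (hle.trans_lt (lt_of_le_of_lt ?_ h))
    exact Nat.le_mul_of_pos_left _ hch
  have he1 : ∀ i, e i = 1 := by
    have h1 : ∑ i : Fin k, 1 = ∑ i, e i :=
      le_antisymm (Finset.sum_le_sum fun i _ => he i) (by simpa using Nat.le_of_lt_succ hsum)
    intro i
    exact ((Finset.sum_eq_sum_iff_of_le fun i _ => he i).1 h1 i (Finset.mem_univ i)).symm
  have hd' : d = ∏ i, (b i * A + 1) := by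
    rw [hd]; exact Finset.prod_congr rfl fun i _ => by rw [he1, pow_one, hpb]
  refine ⟨hA, hb, he1, hd', ?_⟩
  -- Dropping the summands 1 leaves a factor `A ^ k` to cancel against `A ^ (k + 1)`.
  have h2 : (∏ i, b i) * A ^ k ≤ d := by
    calc (∏ i, b i) * A ^ k = ∏ i, (b i * A) := by simp [Finset.prod_mul_distrib]
      _ ≤ d := by rw [hd']; exact Finset.prod_le_prod' fun i _ => Nat.le_succ _
  refine Nat.lt_of_mul_lt_mul_right (a := A ^ k) ?_
  calc _ = k.choose (k / 2) * ((∏ i, b i) * A ^ k) := by ring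
    _ ≤ k.choose (k / 2) * d := Nat.mul_le_mul le_rfl h2
    _ < A ^ (k + 1) := h
    _ = _ := by ring

end Digits

/-! ### Admissible moduli -/

/-- The numbers `b i` are distinct and nonzero modulo `r`. -/
def DistinctUnitsMod {k : ℕ} (b : Fin k → ℕ) (r : ℕ) : Prop :=
  (∀ i, (b i : ZMod r) ≠ 0) ∧ Function.Injective fun i => (b i : ZMod r)

section Admissible

open BHProg

variable {k A d r q : ℕ} {b : Fin k → ℕ}

/-- For `x ≤ r` the subtraction `r - x` is not truncated, and `b i * (r - x) + 1` is `1 - b i * x`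
modulo `r`. -/
theorem negRoot_iff (hdig : ∀ y : ℕ, Nat.ofDigits y (Nat.digits A d) = ∏ i, (b i * y + 1))
    {x : ℕ} (hx : x ≤ r) :
    NegRoot A d r x ↔ (r : ℤ) ∣ ∏ i, (1 - (b i : ℤ) * x) := by
  rw [NegRoot, hdig, ← ZMod.natCast_eq_zero_iff, ← ZMod.intCast_zmod_eq_zero_iff_dvd]
  push_cast [Nat.cast_sub hx]
  rw [ZMod.natCast_self]
  refine Eq.congr_left (Finset.prod_congr rfl fun i _ => ?_)
  ring

theorem negRoot_prime_iff (hr : r.Prime)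
    (hdig : ∀ y : ℕ, Nat.ofDigits y (Nat.digits A d) = ∏ i, (b i * y + 1))
    {x : ℕ} (hx : x ≤ r) :
    NegRoot A d r x ↔ ∃ i, (b i : ZMod r) * x = 1 := by
  have := Fact.mk hr
  rw [negRoot_iff hdig hx, ← ZMod.intCast_zmod_eq_zero_iff_dvd]
  push_cast
  rw [Finset.prod_eq_zero_iff]
  refine ⟨fun ⟨i, _, h⟩ => ⟨i, (sub_eq_zero.1 h).symm⟩, fun ⟨i, h⟩ => ⟨i, Finset.mem_univ i, ?_⟩⟩
  rw [h, sub_self]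

/-- The negated roots are the inverses of the nonzero `b i`. There are `k` of them only if no `b i`
vanishes and no two coincide modulo `r`. -/
theorem count_negRoot_eq_iff (hr : r.Prime)
    (hdig : ∀ y : ℕ, Nat.ofDigits y (Nat.digits A d) = ∏ i, (b i * y + 1)) :
    Nat.count (NegRoot A d r) r = k ↔ DistinctUnitsMod b r := by
  have := Fact.mk hr
  classical
  set S : Finset (Fin k) := Finset.univ.filter fun i => (b i : ZMod r) ≠ 0 with hS
  set f : Fin k → ℕ := fun i => ((b i : ZMod r)⁻¹).val with hf
  have himg : (Finset.range r).filter (NegRoot A d r) = S.image f := by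
    ext x
    simp only [Finset.mem_filter, Finset.mem_range, Finset.mem_image, hS, Finset.mem_univ,
      true_and, hf]
    constructor
    · rintro ⟨hx, h⟩
      obtain ⟨i, hi⟩ := (negRoot_prime_iff hr hdig hx.le).1 h
      refine ⟨i, left_ne_zero_of_mul (hi.trans_ne one_ne_zero), ?_⟩
      rw [inv_eq_of_mul_eq_one_right hi, ZMod.val_cast_of_lt hx]
    · rintro ⟨i, hi, rfl⟩
      refine ⟨ZMod.val_lt _, (negRoot_prime_iff hr hdig (ZMod.val_lt _).le).2 ⟨i, ?_⟩⟩
      rw [ZMod.natCast_zmod_val, mul_inv_cancel₀ hi]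
  have hinj : Set.InjOn f S ↔ Set.InjOn (fun i => (b i : ZMod r)) S := by
    have hff : ∀ i j, f i = f j ↔ (b i : ZMod r) = b j := fun i j =>
      (ZMod.val_injective r).eq_iff.trans inv_inj
    simp only [Set.InjOn, hff]
  rw [Nat.count_eq_card_filter_range, himg, DistinctUnitsMod]
  constructor
  · intro h
    have h1 : (S.image f).card ≤ S.card := Finset.card_image_le
    have h2 : S.card ≤ (Finset.univ : Finset (Fin k)).card := Finset.card_le_univ _
    rw [Finset.card_univ, Fintype.card_fin] at h2
    have h3 : S = Finset.univ := by
      rw [← Finset.card_eq_iff_eq_univ, Fintype.card_fin]; omega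
    have h4 : Set.InjOn f S := Finset.card_image_iff.1 (by omega)
    rw [hinj, h3, Finset.coe_univ, Set.injOn_univ] at h4
    exact ⟨fun i => (Finset.mem_filter.1 (h3 ▸ Finset.mem_univ i : i ∈ S)).2, h4⟩
  · rintro ⟨h0, h1⟩
    have h3 : S = Finset.univ := by rw [hS, Finset.filter_true_of_mem fun i _ => h0 i]
    rw [Finset.card_image_of_injOn (hinj.2 h1.injOn), h3, Finset.card_univ, Fintype.card_fin]

theorem count_dvd_eq_one_iff (hr : 2 ≤ r) : Nat.count (· ∣ r) r = 1 ↔ r.Prime := by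
  have h : (Finset.range r).filter (· ∣ r) = r.properDivisors := by
    ext x
    simp only [Finset.mem_filter, Finset.mem_range, Nat.mem_properDivisors]
    exact and_comm
  rw [Nat.count_eq_card_filter_range, h, ← Nat.properDivisors_eq_singleton_one_iff_prime,
    Finset.card_eq_one]
  constructor
  · rintro ⟨a, ha⟩
    have h1 : 1 ∈ r.properDivisors := Nat.one_mem_properDivisors_iff_one_lt.2 (by omega)
    rw [ha, Finset.mem_singleton] at h1
    rw [ha, h1]
  · exact fun h => ⟨1, h⟩

theorem admissible_iff (hr : 2 ≤ r)
    (hdig : ∀ y : ℕ, Nat.ofDigits y (Nat.digits A d) = ∏ i, (b i * y + 1)) :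
    Admissible A d k r ↔ r.Prime ∧ DistinctUnitsMod b r := by
  rw [Admissible, count_dvd_eq_one_iff hr, and_comm]
  exact and_congr_right fun h => count_negRoot_eq_iff h hdig

theorem leadingCoeff_prod_linear (hb : ∀ i, 1 ≤ b i) :
    (∏ i, (C (b i : ℤ) * X + 1)).leadingCoeff = ∏ i, (b i : ℤ) := by
  rw [leadingCoeff_prod]
  refine Finset.prod_congr rfl fun i _ => ?_
  rw [← C_1, leadingCoeff_linear]
  have := hb i
  positivity

/-- The leading coefficient `∏ b i` detects vanishing residues. Two equal residues give a square
factor, while distinct ones give pairwise coprime linear factors. -/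
theorem squarefree_map_iff (hr : r.Prime) (hb : ∀ i, 1 ≤ b i) :
    (¬ (r : ℤ) ∣ (∏ i, (C (b i : ℤ) * X + 1)).leadingCoeff ∧
      Squarefree ((∏ i, (C (b i : ℤ) * X + 1)).map (Int.castRingHom (ZMod r)))) ↔
      DistinctUnitsMod b r := by
  have := Fact.mk hr
  rw [leadingCoeff_prod_linear hb, ← ZMod.intCast_zmod_eq_zero_iff_dvd, Polynomial.map_prod]
  have hmap : ∀ i, (C (b i : ℤ) * X + 1).map (Int.castRingHom (ZMod r)) =
      C (b i : ZMod r) * X + C 1 := by simp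
  simp only [hmap]
  push_cast
  rw [Finset.prod_eq_zero_iff, DistinctUnitsMod]
  simp only [Finset.mem_univ, true_and, not_exists]
  refine and_congr_right fun h0 => ⟨fun hsq i j hij => ?_, fun hinj => ?_⟩
  · by_contra hne
    have hdvd : (C (b i : ZMod r) * X + C 1) * (C (b i : ZMod r) * X + C 1) ∣
        ∏ i, (C (b i : ZMod r) * X + C 1) := by
      have h2 := Finset.prod_dvd_prod_of_subset {i, j} Finset.univ
        (fun i => (C (b i : ZMod r) * X + C 1)) (Finset.subset_univ _)
      rw [Finset.prod_pair hne] at h2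
      simp only at hij
      rwa [← hij] at h2
    have hu := hsq _ hdvd
    have := natDegree_eq_zero_of_isUnit hu
    rw [natDegree_linear (h0 i)] at this
    omega
  · refine Finset.squarefree_prod_of_pairwise_isCoprime ?_ fun i _ => ?_
    · intro i _ j _ hij
      have hsub : (b i : ZMod r) - b j ≠ 0 := sub_ne_zero.2 fun h => hij (hinj h)
      -- Bézout: `-b j * (b i X + 1) + b i * (b j X + 1) = b i - b j`.
      refine IsCoprime.isRelPrime ⟨C (-(b j : ZMod r) / (b i - b j)),
        C ((b i : ZMod r) / (b i - b j)), ?_⟩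
      have e1 : -(b j : ZMod r) / (b i - b j) + b i / (b i - b j) = 1 := by
        field_simp
        ring
      have e2 : -(b j : ZMod r) / (b i - b j) * b i + b i / (b i - b j) * b j = 0 := by
        field_simp; ring
      calc _ = C (-(b j : ZMod r) / (b i - b j) * b i + b i / (b i - b j) * b j) * X +
            C (-(b j : ZMod r) / (b i - b j) + b i / (b i - b j)) := by
            simp only [C_add, C_mul, C_1]; ring
        _ = 1 := by rw [e1, e2]; simp
    · exact (irreducible_of_degree_eq_one (degree_linear (h0 i))).squarefree

end Admissible

/-! ### Lifted roots, their uniqueness and the resulting factorizations -/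

section Lifting

open BHProg

variable {k A d q m : ℕ} {b : Fin k → ℕ}

theorem modEq_one_iff_eq_mod {M u v x : ℕ} (hx : x < M) (huv : u * v ≡ 1 [MOD M]) :
    x * v ≡ 1 [MOD M] ↔ x = u % M := by
  constructor
  · intro h
    have h1 : x ≡ u [MOD M] := by
      calc x = x * 1 := (mul_one x).symm
        _ ≡ x * (u * v) [MOD M] := huv.symm.mul_left x
        _ = u * (x * v) := by ring
        _ ≡ u * 1 [MOD M] := h.mul_left u
        _ = u := mul_one u
    rw [← h1, Nat.mod_eq_of_lt hx]
  · rintro rfl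
    exact ((Nat.mod_modEq u M).mul_right v).trans huv

theorem natCast_eq_one_iff_modEq {M n : ℕ} : (n : ZMod M) = 1 ↔ n ≡ 1 [MOD M] := by
  rw [← ZMod.natCast_eq_natCast_iff, Nat.cast_one]

theorem exists_modEq_one_of_lt {M u : ℕ} (hM : 0 < M) (h : u.Coprime M) :
    ∃ c < M, u * c ≡ 1 [MOD M] := by
  have : NeZero M := ⟨hM.ne'⟩
  refine ⟨((u : ZMod M)⁻¹).val, ZMod.val_lt _, ?_⟩
  rw [← natCast_eq_one_iff_modEq]
  push_cast
  rw [ZMod.natCast_zmod_val, ZMod.coe_mul_inv_eq_one u h]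

/-- The program finds the roots in increasing order, unrelated to the order of the `b i`; `σ`
matches the two. It is injective because an inverse modulo `q` is unique. -/
theorem exists_perm_roots (hq : q.Prime)
    (hdig : ∀ y : ℕ, Nat.ofDigits y (Nat.digits A d) = ∏ i, (b i * y + 1))
    (hdu : DistinctUnitsMod b q) :
    ∃ σ : Equiv.Perm (Fin k), ∀ i : Fin k, Nat.nth (NegRoot A d q) i < q ∧
      b (σ i) * Nat.nth (NegRoot A d q) i ≡ 1 [MOD q] := by
  have hcount := (count_negRoot_eq_iff hq hdig).2 hdu
  have key : ∀ i : Fin k, ∃ l, Nat.nth (NegRoot A d q) i < q ∧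
      Nat.count (NegRoot A d q) (Nat.nth (NegRoot A d q) i) = i ∧
      b l * Nat.nth (NegRoot A d q) i ≡ 1 [MOD q] := by
    intro i
    obtain ⟨x, hx, hp, hxi⟩ := exists_count_eq (p := NegRoot A d q) (n := q) (i := i)
      (by rw [hcount]; exact i.2)
    obtain ⟨l, hl⟩ := (negRoot_prime_iff hq hdig hx.le).1 hp
    rw [← hxi, Nat.nth_count hp]
    refine ⟨l, hx, rfl, ?_⟩
    rw [← natCast_eq_one_iff_modEq]
    exact_mod_cast hl
  choose σ hσ using key
  have hinj : Function.Injective σ := by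
    intro i j hij
    have h1 := (hσ i).2.2
    have h2 := (hσ j).2.2
    rw [mul_comm] at h1 h2
    rw [← hij] at h2
    have h3 : Nat.nth (NegRoot A d q) i = Nat.nth (NegRoot A d q) j := by
      rw [(modEq_one_iff_eq_mod (hσ i).1 h2).1 h1, Nat.mod_eq_of_lt (hσ j).1]
    ext
    rw [← (hσ i).2.1, ← (hσ j).2.1, h3]
  exact ⟨Equiv.ofBijective σ (Finite.injective_iff_bijective.1 hinj),
    fun i => ⟨(hσ i).1, (hσ i).2.2⟩⟩

/-- The lifted root `c i` is the inverse of `b (σ i)` modulo `q ^ m`. Because the factors are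
explicit, Hensel uniqueness reduces to uniqueness of inverses, without derivatives. -/
theorem exists_liftData (hq : q.Prime)
    (hdig : ∀ y : ℕ, Nat.ofDigits y (Nat.digits A d) = ∏ i, (b i * y + 1))
    (hdu : DistinctUnitsMod b q) (hm : 1 ≤ m) (hblt : ∀ i, b i < q ^ m) :
    ∃ (σ : Equiv.Perm (Fin k)) (c b' : ℕ → ℕ),
      LiftData A d k q m (Nat.nth (NegRoot A d q)) c b' ∧
      (∀ i : Fin k, b' i = b (σ i)) ∧
      (∀ i : Fin k, Nat.nth (NegRoot A d q) i < q ∧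
        b (σ i) * Nat.nth (NegRoot A d q) i ≡ 1 [MOD q]) ∧
      ∀ i : Fin k, b (σ i) * c i ≡ 1 [MOD q ^ m] := by
  obtain ⟨σ, hσ⟩ := exists_perm_roots hq hdig hdu
  have hcop : ∀ i, (b i).Coprime q := fun i => by
    rw [Nat.coprime_comm, hq.coprime_iff_not_dvd, ← ZMod.natCast_eq_zero_iff]
    exact hdu.1 i
  choose c₀ hc₀ using fun i : Fin k =>
    exists_modEq_one_of_lt (pow_pos hq.pos m) ((hcop (σ i)).pow_right m)
  set c : ℕ → ℕ := fun i => if h : i < k then c₀ ⟨i, h⟩ else 0 with hc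
  set b' : ℕ → ℕ := fun i => if h : i < k then b (σ ⟨i, h⟩) else 0 with hb'
  have hcv : ∀ i : Fin k, c i = c₀ i := fun i => by simp [hc]
  have hbv : ∀ i : Fin k, b' i = b (σ i) := fun i => by simp [hb']
  have hinv : ∀ i : Fin k, b (σ i) * c i ≡ 1 [MOD q ^ m] := fun i => by
    rw [hcv]; exact (hc₀ i).2
  have hinvq : ∀ (i : Fin k) (j : ℕ), j ≤ m → b (σ i) * c i ≡ 1 [MOD q ^ j] :=
    fun i j hj => (hinv i).of_dvd (pow_dvd_pow q hj)
  have hcmod : ∀ i : Fin k, c i % q = Nat.nth (NegRoot A d q) i := by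
    intro i
    have h1 : c i * b (σ i) ≡ 1 [MOD q] := by
      rw [mul_comm]; simpa using hinvq i 1 hm
    refine ((modEq_one_iff_eq_mod (hσ i).1 h1).1 ?_).symm
    rw [mul_comm]; exact (hσ i).2
  refine ⟨σ, c, b', ⟨fun i hi => ?_, fun i hi => hcmod ⟨i, hi⟩, fun i hi => ?_, ?_, ?_⟩, hbv, hσ,
    hinv⟩
  · rw [hcv ⟨i, hi⟩]; exact (hc₀ _).1
  · rw [hbv ⟨i, hi⟩]; exact hblt _
  · intro i hi j hjm hj x hx hxj
    have hM : x ≤ q ^ (j + 1) := hx.le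
    set l := σ ⟨i, hi⟩ with hl
    have hxq : x ≡ c i [MOD q] := Nat.ModEq.of_dvd (dvd_pow_self q (by omega)) hxj
    have hlx : b l * x ≡ 1 [MOD q] :=
      (hxq.mul_left _).trans (by simpa using hinvq ⟨i, hi⟩ 1 hm)
    -- If another factor vanished at `x` modulo `q`, then `b n` and `b l` would both invert `x` and
    -- agree modulo `q`. So the whole power of `q` must divide the factor with index `l`.
    have hrest : IsCoprime ((q ^ (j + 1) : ℕ) : ℤ)
        (∏ n ∈ Finset.univ.erase l, (1 - (b n : ℤ) * x)) := by
      refine IsCoprime.prod_right fun n hn => ?_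
      push_cast
      refine IsCoprime.pow_left ((Nat.prime_iff_prime_int.1 hq).coprime_iff_not_dvd.2 fun h => ?_)
      refine Finset.ne_of_mem_erase hn (hdu.2 ?_)
      have h1 : (b n : ZMod q) * x = 1 := by
        rw [← ZMod.intCast_zmod_eq_zero_iff_dvd] at h
        push_cast at h
        exact (sub_eq_zero.1 h).symm
      have h2 : (b l : ZMod q) * x = 1 := by
        exact_mod_cast natCast_eq_one_iff_modEq.2 hlx
      show (b n : ZMod q) = b l
      calc (b n : ZMod q) = b n * (b l * x) := by rw [h2, mul_one]
        _ = b l * (b n * x) := by ring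
        _ = b l := by rw [h1, mul_one]
    rw [negRoot_iff hdig hM, ← Finset.mul_prod_erase _ _ (Finset.mem_univ l),
      (⟨hrest.dvd_of_dvd_mul_right, fun h => h.mul_right _⟩ :
        ((q ^ (j + 1) : ℕ) : ℤ) ∣ (1 - (b l : ℤ) * x) * _ ↔ _ ∣ 1 - (b l : ℤ) * x)]
    have h3 : c i * b l ≡ 1 [MOD q ^ (j + 1)] := by
      rw [mul_comm]; exact hinvq ⟨i, hi⟩ (j + 1) hjm
    rw [← modEq_one_iff_eq_mod hx h3, ← natCast_eq_one_iff_modEq,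
      ← ZMod.intCast_zmod_eq_zero_iff_dvd]
    push_cast
    rw [sub_eq_zero, mul_comm, eq_comm]
  · intro i hi j hjm x hx
    have hpos : 0 < q ^ (j + 1) := pow_pos hq.pos _
    have h3 : b' i * c i ≡ 1 [MOD q ^ (j + 1)] := by
      rw [hbv ⟨i, hi⟩]; exact hinvq ⟨i, hi⟩ (j + 1) hjm
    rw [← modEq_one_iff_eq_mod hx h3, ← natCast_eq_one_iff_modEq, ← Nat.dvd_iff_mod_eq_zero,
      ← ZMod.natCast_eq_zero_iff]
    push_cast [Nat.cast_sub (Nat.one_le_of_lt hpos)]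
    rw [← sub_eq_zero (b := (1 : ZMod (q ^ (j + 1))))]
    have : (q : ZMod (q ^ (j + 1))) ^ (j + 1) = 0 := by
      exact_mod_cast ZMod.natCast_self (q ^ (j + 1))
    rw [this, zero_sub, ← sub_eq_add_neg]

/-- Factor by factor, `b X + 1 = b (X + β)` when `b β = 1`. Any modulus is allowed, so both `q` and
`q ^ m` are covered. -/
theorem map_prod_linear_eq {n : ℕ} (hb : ∀ i, 1 ≤ b i) (σ : Equiv.Perm (Fin k)) (β : ℕ → ℕ)
    (hβ : ∀ i : Fin k, b (σ i) * β i ≡ 1 [MOD n]) :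
    (∏ i, (C (b i : ℤ) * X + 1)).map (Int.castRingHom (ZMod n)) =
      C ((∏ i, (C (b i : ℤ) * X + 1)).leadingCoeff : ZMod n) *
        ∏ i ∈ Finset.range k, (X + C (β i : ZMod n)) := by
  rw [leadingCoeff_prod_linear hb, Polynomial.map_prod, Finset.prod_range]
  push_cast
  rw [← Equiv.prod_comp σ, ← Equiv.prod_comp σ (fun i => (b i : ZMod n)), map_prod,
    ← Finset.prod_mul_distrib]
  refine Finset.prod_congr rfl fun i _ => ?_
  have h : (b (σ i) : ZMod n) * β i = 1 := by
    exact_mod_cast natCast_eq_one_iff_modEq.2 (hβ i)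
  rw [mul_add, ← C_mul, h]
  simp

theorem berlekampHensel_of_liftData {σ : Equiv.Perm (Fin k)} {β c b' : ℕ → ℕ}
    (hb : ∀ i, 1 ≤ b i) (hg : digitPoly A d = ∏ i, (C (b i : ℤ) * X + 1)) (hq : q.Prime)
    (hdu : DistinctUnitsMod b q) (hmin : ∀ r < q, r.Prime → ¬ DistinctUnitsMod b r)
    (hm : m = Nat.clog q d)
    (hβ : ∀ i : Fin k, β i < q ∧ b (σ i) * β i ≡ 1 [MOD q])
    (hc : ∀ i : Fin k, c i < q ^ m ∧ c i % q = β i ∧ b (σ i) * c i ≡ 1 [MOD q ^ m])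
    (hb' : ∀ i : Fin k, b' i = b (σ i) ∧ b' i < q ^ m) :
    BerlekampHensel (digitPoly A d) d k q m β c b' where
  prime := by
    rw [hg]
    refine ⟨⟨hq, (squarefree_map_iff hq hb).2 hdu⟩, fun r ⟨hr, h⟩ => ?_⟩
    by_contra hlt
    exact hmin r (not_le.1 hlt) hr ((squarefree_map_iff hr hb).1 h)
  factor_lt i hi := (hβ ⟨i, hi⟩).1
  factor := by rw [hg]; exact map_prod_linear_eq hb σ β fun i => (hβ i).2
  precision := hm
  lift_lt i hi := (hc ⟨i, hi⟩).1
  lift_modEq i hi := by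
    rw [← (hc ⟨i, hi⟩).2.1]; exact (Nat.mod_modEq _ _).symm
  lift := by rw [hg]; exact map_prod_linear_eq hb σ c fun i => (hc i).2.2
  inverse_lt i hi := (hb' ⟨i, hi⟩).2
  inverse i hi := by
    rw [(hb' ⟨i, hi⟩).1]; exact (hc ⟨i, hi⟩).2.2

end Lifting

/-! ### Size of the least admissible prime -/

/-- A Chebyshev lower bound for `θ(n)`, with main term `n log 2`. In terms of the fourth root `u` of
`n`, `log n ≤ 4 u` makes the errors `O(u³)`. The summand 1 takes care of small `n`. -/
theorem exists_le_mul_one_add_log_primorial :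
    ∃ C : ℝ, 1 ≤ C ∧ ∀ n : ℕ, (n : ℝ) ≤ C * (1 + Real.log (primorial n)) := by
  refine ⟨10 ^ 7, by norm_num, fun n => ?_⟩
  have hθ : Real.log (primorial n) = Chebyshev.theta n := by
    rw [Chebyshev.theta_eq_log_primorial, Nat.floor_natCast]
  have h0 : 0 ≤ Chebyshev.theta n := Chebyshev.theta_nonneg _
  rw [hθ]
  rcases Nat.eq_zero_or_pos n with rfl | hn
  · push_cast; positivity
  have hge := Chebyshev.theta_ge n
  have hn1 : (1 : ℝ) ≤ n := by exact_mod_cast hn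
  set v := √(n : ℝ) with hv
  set u := √v with hu
  have hu0 : 0 ≤ u := Real.sqrt_nonneg _
  have huv : u ^ 2 = v := Real.sq_sqrt (Real.sqrt_nonneg _)
  have hvn : v ^ 2 = n := Real.sq_sqrt (by positivity)
  have hun : u ^ 4 = n := by rw [← hvn, ← huv]; ring
  have hu1 : 1 ≤ u := by
    rw [hu, Real.one_le_sqrt, hv, Real.one_le_sqrt]; exact hn1
  have hlog : Real.log n ≤ 4 * u := by
    rw [← hun, Real.log_pow]
    push_cast
    have := Real.log_le_self hu0
    linarith
  have hlog' : Real.log (n + 1) ≤ 1 + 4 * u := by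
    have h1 : Real.log (n + 1) ≤ Real.log (2 * n) :=
      Real.log_le_log (by positivity) (by linarith)
    rw [Real.log_mul (by norm_num) (by positivity)] at h1
    have := Real.log_two_lt_d9
    linarith
  have h2 : 2 * v * Real.log n ≤ 8 * u ^ 3 := by
    calc 2 * v * Real.log n ≤ 2 * v * (4 * u) := by gcongr
      _ = 8 * u ^ 3 := by rw [← huv]; ring
  have h3 : (n : ℝ) * 0.69 ≤ n * Real.log 2 := by
    gcongr
    have := Real.log_two_gt_d9
    linarith
  have h4 : (n : ℝ) / 4 ≤ 10 ^ 6 + Chebyshev.theta n := by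
    have h5 : (n : ℝ) * 0.69 - (1 + 4 * u) - 8 * u ^ 3 ≤ Chebyshev.theta n := by linarith
    rw [← hun] at h5 ⊢
    -- Up to 40 the errors are at most `8 * 40 ^ 3 + 161 < 10 ^ 6`; beyond 40 they are a small
    -- fraction of `u ^ 4`.
    rcases le_or_gt u 40 with h | h
    · have : u ^ 3 ≤ 40 ^ 3 := by gcongr
      have : (0 : ℝ) ≤ u ^ 4 := by positivity
      linarith
    · have : 40 * u ^ 3 ≤ u ^ 4 := by
        rw [pow_succ u 3, mul_comm]; gcongr
      have : (0 : ℝ) ≤ u ^ 3 := by positivity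
      have : 40 * u ≤ u ^ 3 := by nlinarith
      linarith
  linarith

/-! ### Logarithmic bounds for the prime, the degree, the precision and the lengths -/

section Bounds

variable {k A d q : ℕ} {b : Fin k → ℕ}

/-- A nonzero number divisible by every prime modulo which the `b i` are not distinct units. -/
def discriminantBound (b : Fin k → ℕ) : ℕ :=
  ∏ i, (b i * ∏ j ∈ Finset.univ.erase i, Nat.dist (b i) (b j))

theorem discriminantBound_pos (hb : ∀ i, 1 ≤ b i) (hinj : Function.Injective b) :
    0 < discriminantBound b := by
  refine Finset.prod_pos fun i _ => Nat.mul_pos (hb i) (Finset.prod_pos fun j hj => ?_)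
  refine Nat.dist_pos_of_ne fun h => Finset.ne_of_mem_erase hj (hinj h).symm

theorem dvd_discriminantBound {r : ℕ} (hr : ¬ DistinctUnitsMod b r) :
    r ∣ discriminantBound b := by
  rw [DistinctUnitsMod, not_and_or] at hr
  rcases hr with h | h
  · push Not at h
    obtain ⟨i, hi⟩ := h
    rw [ZMod.natCast_eq_zero_iff] at hi
    exact (hi.mul_right _).trans (Finset.dvd_prod_of_mem _ (Finset.mem_univ i))
  · rw [Function.Injective] at h
    push Not at h
    obtain ⟨i, j, hij, hne⟩ := h
    have h1 : r ∣ Nat.dist (b i) (b j) := by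
      rw [ZMod.natCast_eq_natCast_iff] at hij
      rw [Nat.dist]
      rcases le_total (b i) (b j) with hle | hle
      · rw [Nat.sub_eq_zero_of_le hle, zero_add]
        exact (Nat.modEq_iff_dvd' hle).1 hij
      · rw [Nat.sub_eq_zero_of_le hle, add_zero]
        exact (Nat.modEq_iff_dvd' hle).1 hij.symm
    refine (Dvd.dvd.mul_left ?_ _).trans (Finset.dvd_prod_of_mem _ (Finset.mem_univ i))
    exact h1.trans (Finset.dvd_prod_of_mem _ (Finset.mem_erase.2 ⟨Ne.symm hne, Finset.mem_univ j⟩))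

/-- The crude estimate `|b i - b j| ≤ b i * b j` bounds the whole product by `(∏ b i) ^ (2 k)`,
hence by `A ^ (2 k)`. -/
theorem discriminantBound_le (hb : ∀ i, 1 ≤ b i) (hA : ∏ i, b i ≤ A) (hd : A ^ k ≤ d) :
    discriminantBound b ≤ d ^ 2 := by
  have hdist : ∀ i j, Nat.dist (b i) (b j) ≤ b i * b j := fun i j => by
    have h1 := hb i
    have h2 := hb j
    rw [Nat.dist]
    rcases le_total (b i) (b j) with h | h
    · rw [Nat.sub_eq_zero_of_le h, zero_add]
      exact (Nat.sub_le _ _).trans (Nat.le_mul_of_pos_left _ h1)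
    · rw [Nat.sub_eq_zero_of_le h, add_zero]
      exact (Nat.sub_le _ _).trans (Nat.le_mul_of_pos_right _ h2)
  have hterm : ∀ i, b i * ∏ j ∈ Finset.univ.erase i, Nat.dist (b i) (b j) ≤
      b i ^ k * ∏ j, b j := by
    intro i
    have hk : 1 ≤ k := Nat.one_le_of_lt i.2
    calc b i * ∏ j ∈ Finset.univ.erase i, Nat.dist (b i) (b j)
        ≤ b i * ∏ j ∈ Finset.univ.erase i, (b i * b j) :=
          Nat.mul_le_mul le_rfl (Finset.prod_le_prod' fun j _ => hdist i j)
      _ = b i ^ (k - 1) * (b i * ∏ j ∈ Finset.univ.erase i, b j) := by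
          rw [Finset.prod_mul_distrib, Finset.prod_const,
            Finset.card_erase_of_mem (Finset.mem_univ i), Finset.card_univ, Fintype.card_fin]
          ring
      _ = b i ^ (k - 1) * ∏ j, b j := by rw [Finset.mul_prod_erase _ _ (Finset.mem_univ i)]
      _ ≤ b i ^ k * ∏ j, b j :=
          Nat.mul_le_mul (Nat.pow_le_pow_right (hb i) (Nat.sub_le _ _)) le_rfl
  calc discriminantBound b ≤ ∏ i, (b i ^ k * ∏ j, b j) := Finset.prod_le_prod' fun i _ => hterm i
    _ = (∏ i, b i) ^ k * (∏ i, b i) ^ k := by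
        rw [Finset.prod_mul_distrib, Finset.prod_pow, Finset.prod_const, Finset.card_univ,
          Fintype.card_fin]
    _ ≤ d * d := Nat.mul_le_mul ((Nat.pow_le_pow_left hA k).trans hd)
        ((Nat.pow_le_pow_left hA k).trans hd)
    _ = d ^ 2 := (sq d).symm

theorem exists_least_prime (hb : ∀ i, 1 ≤ b i) (hinj : Function.Injective b) :
    ∃ q, q.Prime ∧ DistinctUnitsMod b q ∧
      ∀ r < q, r.Prime → ¬ DistinctUnitsMod b r := by
  classical
  have hex : ∃ q, q.Prime ∧ DistinctUnitsMod b q := by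
    obtain ⟨q, hle, hq⟩ := Nat.exists_infinite_primes (discriminantBound b + 1)
    refine ⟨q, hq, ?_⟩
    by_contra h
    have := Nat.le_of_dvd (discriminantBound_pos hb hinj) (dvd_discriminantBound h)
    omega
  exact ⟨Nat.find hex, (Nat.find_spec hex).1, (Nat.find_spec hex).2,
    fun r hr hp h => Nat.find_min hex hr ⟨hp, h⟩⟩

theorem primorial_dvd_of_forall_prime_dvd {n N : ℕ} (h : ∀ r ≤ n, r.Prime → r ∣ N) :
    primorial n ∣ N := by
  refine Finset.prod_primes_dvd N (fun r hr => ?_) fun r hr => ?_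
  · exact (Finset.mem_filter.1 hr).2.prime
  · obtain ⟨h1, h2⟩ := Finset.mem_filter.1 hr
    exact h r (Nat.lt_succ_iff.1 (Finset.mem_range.1 h1)) h2

theorem log_primorial_pred_le (hb : ∀ i, 1 ≤ b i) (hinj : Function.Injective b)
    (hA : ∏ i, b i ≤ A) (hd : A ^ k ≤ d) (hq : 1 ≤ q)
    (hmin : ∀ r < q, r.Prime → ¬ DistinctUnitsMod b r) :
    Real.log (primorial (q - 1)) ≤ 2 * Real.log d := by
  have h1 : primorial (q - 1) ≤ d ^ 2 :=
    (Nat.le_of_dvd (discriminantBound_pos hb hinj) (primorial_dvd_of_forall_prime_dvd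
      fun r hr hp => dvd_discriminantBound (hmin r (by omega) hp))).trans
      (discriminantBound_le hb hA hd)
  calc Real.log (primorial (q - 1)) ≤ Real.log ((d : ℝ) ^ 2) :=
        Real.log_le_log (by exact_mod_cast primorial_pos _) (by exact_mod_cast h1)
    _ = 2 * Real.log d := by rw [Real.log_pow]; norm_num

/-- At most one of the distinct `b i` equals 1; the others are at least 2. -/
theorem two_pow_pred_le_prod (hb : ∀ i, 1 ≤ b i) (hinj : Function.Injective b) :
    2 ^ (k - 1) ≤ ∏ i, b i := by
  classical
  have h1 : (Finset.univ.filter fun i => b i = 1).card ≤ 1 := by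
    refine Finset.card_le_one.2 fun i hi j hj => hinj ?_
    rw [(Finset.mem_filter.1 hi).2, (Finset.mem_filter.1 hj).2]
  have h2 : k - 1 ≤ (Finset.univ.filter fun i => ¬ b i = 1).card := by
    have := Finset.card_filter_add_card_filter_not (s := (Finset.univ : Finset (Fin k)))
      (fun i => b i = 1)
    rw [Finset.card_univ, Fintype.card_fin] at this
    omega
  calc 2 ^ (k - 1) ≤ 2 ^ (Finset.univ.filter fun i => ¬ b i = 1).card :=
        Nat.pow_le_pow_right (by norm_num) h2
    _ ≤ ∏ i ∈ Finset.univ.filter fun i => ¬ b i = 1, b i := by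
        refine Finset.pow_card_le_prod _ _ _ fun i hi => ?_
        have := hb i
        have := (Finset.mem_filter.1 hi).2
        omega
    _ ≤ ∏ i, b i := Finset.prod_le_prod_of_subset_of_one_le' (Finset.filter_subset _ _)
        fun i _ _ => hb i

/-- Both `2 ^ ((k - 1) * k)` and `2 ^ k` are at most `A ^ k ≤ d`, so `2 ^ (k ^ 2) ≤ d ^ 2`; then
`log 2 > 1 / 2` is used. -/
theorem sq_le_four_mul_log (hb : ∀ i, 1 ≤ b i) (hinj : Function.Injective b) (hA2 : 2 ≤ A)
    (hA : ∏ i, b i ≤ A) (hd : A ^ k ≤ d) : (k : ℝ) ^ 2 ≤ 4 * Real.log d := by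
  have h1 : 2 ^ ((k - 1) * k) ≤ d := by
    rw [pow_mul]
    exact (Nat.pow_le_pow_left ((two_pow_pred_le_prod hb hinj).trans hA) k).trans hd
  have h2 : 2 ^ k ≤ d := (Nat.pow_le_pow_left hA2 k).trans hd
  have h3 : 2 ^ (k ^ 2) ≤ d ^ 2 := by
    have : k ^ 2 = (k - 1) * k + k := by
      rcases k with _ | k
      · rfl
      · simp only [add_tsub_cancel_right]; ring
    rw [this, pow_add, sq]
    exact Nat.mul_le_mul h1 h2
  have h4 : Real.log ((2 : ℝ) ^ (k ^ 2)) ≤ Real.log ((d : ℝ) ^ 2) :=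
    Real.log_le_log (by positivity) (by exact_mod_cast h3)
  rw [Real.log_pow, Real.log_pow] at h4
  push_cast at h4
  have := Real.log_two_gt_d9
  nlinarith [sq_nonneg (k : ℝ)]

theorem natClog_le_log (hq : 2 ≤ q) (hd : 2 ≤ d) :
    (Nat.clog q d : ℝ) ≤ 1 + 2 * Real.log d := by
  obtain ⟨n, hn⟩ := Nat.exists_eq_add_of_le' (Nat.clog_pos (by omega) hd : 0 < Nat.clog q d)
  have h1 : 2 ^ n ≤ d :=
    (Nat.pow_le_pow_left hq n).trans (Nat.pow_lt_of_lt_clog (by omega) : q ^ n < d).le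
  have h2 : Real.log ((2 : ℝ) ^ n) ≤ Real.log d :=
    Real.log_le_log (by positivity) (by exact_mod_cast h1)
  rw [Real.log_pow] at h2
  have := Real.log_two_gt_d9
  rw [hn]
  push_cast
  nlinarith [(Nat.cast_nonneg n : (0 : ℝ) ≤ n)]

theorem natSize_le_log {n : ℕ} (hn : 1 ≤ n) : (n.size : ℝ) ≤ 1 + 2 * Real.log n := by
  obtain ⟨l, hl⟩ := Nat.exists_eq_add_of_le' (Nat.size_pos.2 hn)
  have h1 : 2 ^ l ≤ n := Nat.lt_size.1 (by omega)
  have h2 : Real.log ((2 : ℝ) ^ l) ≤ Real.log n :=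
    Real.log_le_log (by positivity) (by exact_mod_cast h1)
  rw [Real.log_pow] at h2
  have := Real.log_two_gt_d9
  rw [hl]
  push_cast
  nlinarith [(Nat.cast_nonneg l : (0 : ℝ) ≤ l)]

theorem BHProg.steps_le {m : ℕ} (hk : 1 ≤ k) (hq : 1 ≤ q) (hm : 1 ≤ m) :
    BHProg.steps k q m ≤ 100 * (q ^ 2 * k + k ^ 2 * m * q) := by
  -- With each variable written as a successor, the inequality can be compared monomial by monomial.
  obtain ⟨k, rfl⟩ := Nat.exists_eq_add_of_le' hk
  obtain ⟨q, rfl⟩ := Nat.exists_eq_add_of_le' hq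
  obtain ⟨m, rfl⟩ := Nat.exists_eq_add_of_le' hm
  rw [BHProg.steps]
  ring_nf
  omega

end Bounds

/-! ### The running time and the theorem -/

theorem inputState_boundedBy {d A B : ℕ} (hd : d ≤ B) (hA : A ≤ B) :
    (inputState d A).BoundedBy B := by
  refine ⟨fun i => ?_, fun _ _ => Nat.zero_le _⟩
  simp only [inputState]
  split_ifs
  exacts [hd, hA, Nat.zero_le _]

/-- A cubic bound for the number of steps and a linear bound for the length of the numbers. -/
theorem exists_steps_le_and_size_le :
    ∃ C : ℝ, 0 ≤ C ∧ ∀ (k A d q : ℕ) (b : Fin k → ℕ), 1 ≤ k → (∀ i, 1 ≤ b i) →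
      Function.Injective b → 2 ≤ A → ∏ i, b i ≤ A → A ^ k ≤ d → 3 ≤ d → 2 ≤ q →
      (∀ r < q, r.Prime → ¬ DistinctUnitsMod b r) →
      (BHProg.steps k q (Nat.clog q d) : ℝ) ≤ C * Real.log d ^ 3 ∧
      ((d * q).size : ℝ) ≤ C * Real.log d := by
  obtain ⟨C₀, hC₀, hprim⟩ := exists_le_mul_one_add_log_primorial
  set C₁ : ℝ := 4 * C₀ with hC₁
  -- The sum of the constant for the steps and the constant for the length.
  refine ⟨100 * (4 * C₁ ^ 2 + 12 * C₁) + (5 + 2 * C₁), by positivity, ?_⟩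
  intro k A d q b hk hb hinj hA2 hA hd hd3 hq hmin
  set L := Real.log d with hL
  have hd0 : (0 : ℝ) < d := by positivity
  have hL1 : 1 ≤ L := by
    rw [hL, Real.le_log_iff_exp_le hd0]
    have h3 : (3 : ℝ) ≤ d := by exact_mod_cast hd3
    linarith [Real.exp_one_lt_d9]
  have hqL : (q : ℝ) ≤ C₁ * L := by
    have h1 := log_primorial_pred_le hb hinj hA hd (by omega) hmin
    have h2 := hprim (q - 1)
    rw [Nat.cast_sub (by omega), Nat.cast_one] at h2
    have h3 : C₀ * (1 + Real.log (primorial (q - 1))) ≤ C₀ * (1 + 2 * L) := by gcongr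
    nlinarith
  have hC₁0 : 0 ≤ C₁ := by positivity
  have hk2 : (k : ℝ) ^ 2 ≤ 4 * L := sq_le_four_mul_log hb hinj hA2 hA hd
  have hkL : (k : ℝ) ≤ 4 * L := by
    have : (1 : ℝ) ≤ k := by exact_mod_cast hk
    nlinarith
  have hm : (Nat.clog q d : ℝ) ≤ 3 * L := by linarith [natClog_le_log hq (show 2 ≤ d by omega)]
  have hsteps : (BHProg.steps k q (Nat.clog q d) : ℝ) ≤
      100 * ((q : ℝ) ^ 2 * k + (k : ℝ) ^ 2 * Nat.clog q d * q) := by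
    exact_mod_cast BHProg.steps_le hk (by omega) (Nat.clog_pos (by omega) (by omega))
  constructor
  · calc (BHProg.steps k q (Nat.clog q d) : ℝ)
        ≤ 100 * ((q : ℝ) ^ 2 * k + (k : ℝ) ^ 2 * Nat.clog q d * q) := hsteps
      _ ≤ 100 * ((C₁ * L) ^ 2 * (4 * L) + 4 * L * (3 * L) * (C₁ * L)) := by gcongr
      _ = 100 * (4 * C₁ ^ 2 + 12 * C₁) * L ^ 3 := by ring
      _ ≤ _ := by
        gcongr
        linarith
  · have h1 := natSize_le_log (n := d * q) (by nlinarith)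
    have hq0 : (0 : ℝ) < q := by positivity
    push_cast at h1
    rw [Real.log_mul hd0.ne' hq0.ne', ← hL] at h1
    have h2 : Real.log q ≤ q := Real.log_le_self hq0.le
    calc ((d * q).size : ℝ) ≤ 1 + 2 * (L + C₁ * L) := by linarith
      _ ≤ (5 + 2 * C₁) * L := by nlinarith
      _ ≤ _ := by
        refine mul_le_mul_of_nonneg_right ?_ (by linarith)
        have : 0 ≤ 100 * (4 * C₁ ^ 2 + 12 * C₁) := by positivity
        linarith

theorem mainTheorem10 :
    ∃ (P : MachineProg) (K : ℝ),
      ∀ (k : ℕ) (p e b : Fin k → ℕ) (A d : ℕ),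
        (∀ i, (p i).Prime) → Function.Injective p → (∀ i, 1 ≤ e i) →
        d = ∏ i, p i ^ e i →
        (∀ i, p i = b i * A + 1) →
        k.choose (k / 2) * d < A ^ (k + 1) →
        (∀ i, e i = 1) ∧
        (∃ a : Fin k → ℕ, Nat.digits A d = 1 :: List.ofFn a ∧
          digitPoly A d = 1 + ∑ i : Fin k, C (a i : ℤ) * X ^ (i.val + 1)) ∧
        digitPoly A d = ∏ i, (C (b i : ℤ) * X + 1) ∧
        (1 ≤ k → ∃ (s : MachineState) (t : ℕ),
          P.Exec (inputState d A) s t ∧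
          (t : ℝ) ≤ K * Real.log d ^ 5 * Real.log (Real.log d) ^ 2 ∧
          s.reg 0 = k ∧
          BerlekampHensel (digitPoly A d) d k (s.reg 1) (s.reg 2) (s.arr 0) (s.arr 1) (s.arr 2) ∧
          ∃ σ : Equiv.Perm (Fin k), ∀ i : Fin k, s.arr 2 i = b (σ i)) := by
  obtain ⟨c, hc⟩ := BHProg.main.exists_exec_of_runsTo
  obtain ⟨C₂, hC₂, hbound⟩ := exists_steps_le_and_size_le
  set κ := Real.log (Real.log 3) with hκ
  have hlog3 : 1 < Real.log 3 := by
    rw [Real.lt_log_iff_exp_lt (by norm_num)]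
    linarith [Real.exp_one_lt_d9]
  have hκ0 : 0 < κ := Real.log_pos hlog3
  refine ⟨BHProg.main, c * C₂ ^ 3 / κ ^ 2, fun k p e b A d hp hpinj he hd hpb h => ?_⟩
  obtain ⟨hA, hb, he1, hd', hlt⟩ := exponents_eq_one hp he hd hpb h
  have hg := digitPoly_eq_prod hb hA hd' hlt
  refine ⟨he1, exists_digits_eq hb hA hd' hlt, hg, fun hk => ?_⟩
  have hinj : Function.Injective b := fun i j hij => hpinj (by rw [hpb, hpb, hij])
  have hch : 1 ≤ k.choose (k / 2) := Nat.choose_pos (Nat.div_le_self _ _)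
  have hbA : ∏ i, b i ≤ A := (Nat.le_mul_of_pos_left _ hch).trans hlt.le
  have hlo : A ^ k ≤ d := by
    rw [hd']
    calc A ^ k = ∏ _i : Fin k, A := by simp
      _ ≤ _ := Finset.prod_le_prod' fun i _ => by nlinarith [hb i]
  have hhi : d < A ^ (k + 1) := (Nat.le_mul_of_pos_left _ hch).trans_lt h
  have hAd : A ≤ d := (Nat.le_self_pow (by omega) A).trans hlo
  -- A prime divisor `b i * A + 1` is at least 3. This keeps `log (log d)` at least `κ > 0`.
  have hd3 : 3 ≤ d := by
    have h1 : (p ⟨0, hk⟩) ∣ d := by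
      rw [hd]
      exact (dvd_pow_self _ (by have := he ⟨0, hk⟩; omega)).trans
        (Finset.dvd_prod_of_mem _ (Finset.mem_univ _))
    have h2 := Nat.le_of_dvd (by omega) h1
    rw [hpb] at h2
    nlinarith [hb ⟨0, hk⟩]
  have hdig : ∀ y : ℕ, Nat.ofDigits y (Nat.digits A d) = ∏ i, (b i * y + 1) := fun y => by
    simpa using ofDigits_digits_prod hb hA hd' hlt y
  obtain ⟨q, hq, hdu, hmin⟩ := exists_least_prime hb hinj
  have hm : 1 ≤ Nat.clog q d := Nat.clog_pos hq.one_lt (by omega)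
  -- `b i ≤ ∏ b i < A ≤ d ≤ q ^ m`, so the residue modulo `q ^ m` determines the integer `b i`.
  have hblt : ∀ i, b i < q ^ Nat.clog q d := fun i => by
    refine lt_of_lt_of_le ?_ (Nat.le_pow_clog hq.one_lt d)
    refine lt_of_lt_of_le (lt_of_le_of_lt ?_ hlt) hAd
    refine le_trans ?_ (Nat.le_mul_of_pos_left _ hch)
    exact Finset.single_le_prod' (fun i _ => hb i) (Finset.mem_univ i)
  obtain ⟨σ, c', b', hL, hbσ, hβ, hcσ⟩ := exists_liftData hq hdig hdu hm hblt
  obtain ⟨s, n, hrun, hn, e0, e1, e2, h0, h1, h2⟩ := BHProg.main_ensures hA hk hlo hhi hq.two_le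
    ((admissible_iff hq.two_le hdig).2 ⟨hq, hdu⟩)
    (fun r hr hrq hadm => by
      obtain ⟨hr1, hr2⟩ := (admissible_iff hr hdig).1 hadm
      exact hmin r hrq hr1 hr2) hL
  have hdq : d ≤ d * q := Nat.le_mul_of_pos_right _ hq.pos
  obtain ⟨t, hexec, ht⟩ := hc (d * q) _ _ _ (by omega)
    (inputState_boundedBy hdq (hAd.trans hdq)) hrun
  obtain ⟨hsteps, hsize⟩ :=
    hbound k A d q b hk hb hinj hA hbA hlo hd3 hq.two_le hmin
  refine ⟨s, t, hexec, ?_, e0, ?_, σ, fun i => by rw [h2 i i.2, hbσ]⟩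
  · have h3 : (3 : ℝ) ≤ d := by exact_mod_cast hd3
    have hlog : Real.log 3 ≤ Real.log d := Real.log_le_log (by norm_num) h3
    have hκd : κ ≤ Real.log (Real.log d) := Real.log_le_log (by linarith) hlog
    have hL0 : 0 ≤ Real.log d := by linarith
    have hn' : (n : ℝ) ≤ C₂ * Real.log d ^ 3 := le_trans (by exact_mod_cast hn) hsteps
    calc (t : ℝ) ≤ c * n * (d * q).size ^ 2 := by exact_mod_cast ht
      _ ≤ c * (C₂ * Real.log d ^ 3) * (C₂ * Real.log d) ^ 2 := by gcongr
      _ = c * C₂ ^ 3 * Real.log d ^ 5 * 1 := by ring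
      -- The fifth power alone suffices; the inserted quotient is at least 1.
      _ ≤ c * C₂ ^ 3 * Real.log d ^ 5 * (Real.log (Real.log d) ^ 2 / κ ^ 2) := by
        gcongr
        rw [one_le_div (by positivity)]
        gcongr
      _ = _ := by ring
  · rw [e1, e2]
    refine berlekampHensel_of_liftData (σ := σ) hb hg hq hdu hmin rfl
      (fun i => ?_) (fun i => ?_) fun i => ?_
    · rw [h0 i i.2]; exact hβ i
    · rw [h1 i i.2, h0 i i.2]
      exact ⟨hL.lift_lt i i.2, hL.lift_mod i i.2, hcσ i⟩
    · rw [h2 i i.2]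
      exact ⟨hbσ i, hL.inverse_lt i i.2⟩
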